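/- **Theorem.** Let $k$ be a field and let $\mathfrak h$ be a finite-dimensional right Leibniz $k$-algebra, i.e. a vector space with a bilinear bracket satisfying $[[x,y],z]=[[x,z],y]+[x,[y,z]]$. Let $\mathbf b=(y_1,\dots,y_n)$ be a basis with structure constants $[y_i,y_j]=\sum_l C^l_{ij}y_l$. Let $\mathfrak h_{Lie}$ be the quotient of $\mathfrak h$ by the two-sided ideal generated by all $[x,x]$, and let $\tilde y$ be the image of $y\in\mathfrak h$ in $\mathfrak h_{Lie}\to U(\mathfrak h_{Lie})$, where the universal enveloping algebra $U(\mathfrak h_{Lie})$ carries its usual Hopf structure ($\tilde y$ primitive). Let $\mathcal O=\mathcal O(\mathrm{Aut}(\mathfrak h))$ be the commutative Hopf algebra of regular functions on the affine algebraic group of automorphisms of $\mathfrak h$: it has generators $\mathcal G^i_j,\bar{\mathcal G}^i_j$ (the matrix entries, in the basis $\mathbf b$, of an automorphism and of its inverse), relations $$\sum_{l,m}C^r_{lm}\mathcal G^l_i\mathcal G^m_j=\sum_l\mathcal G^r_lC^l_{ij},\qquad \sum_l\mathcal G^i_l\bar{\mathcal G}^l_j=\delta^i_j=\sum_l\bar{\mathcal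 G}^i_l\mathcal G^l_j,$$ and $\Delta\mathcal G^i_j=\sum_l\mathcal G^i_l\otimes\mathcal G^l_j$, $\Delta\bar{\mathcal G}^i_j=\sum_l\bar{\mathcal G}^l_j\otimes\bar{\mathcal G}^i_l$, $\epsilon(\mathcal G^i_j)=\epsilon(\bar{\mathcal G}^i_j)=\delta^i_j$, $S(\mathcal G^i_j)=\bar{\mathcal G}^i_j$, $S(\bar{\mathcal G}^i_j)=\mathcal G^i_j$. Then: 1. There is a unique Hopf pairing $\langle-,-\rangle\colon U(\mathfrak h_{Lie})\otimes\mathcal O\to k$ with $\langle\tilde y_l,\mathcal G^i_j\rangle=-C^i_{jl}$ for all $i,j,l$. The formula $u\blacktriangleleft f:=\langle u_{(1)},f\rangle u_{(2)}$ is a right Hopf action of $\mathcal O$ on $U(\mathfrak h_{Lie})$ (it makes $U(\mathfrak h_{Lie})$ a right $\mathcal O$-module algebra), and $(h\sharp a)(f\sharp b)=hf_{(1)}\sharp(a\blacktriangleleft f_{(2)})b$ makes $\mathcal O\otimes U(\mathfrak h_{Lie})$ an associative algebra $\mathcal O\sharp U(\mathfrak h_{Lie})$ with unit $1\sharp 1$.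 2. There is a unique $k$-linear unital antimultiplicative map $\lambda\colon U(\mathfrak h_{Lie})\to\mathcal O\sharp U(\mathfrak h_{Lie})$ (that is, $\lambda(1)=1\sharp 1$ and $\lambda(vz)=\lambda(z)\lambda(v)$) such that $\lambda(\tilde y_j)=\sum_i\bar{\mathcal G}^i_j\sharp\tilde y_i$ for all $j$. 3. $\lambda$ is a left $\mathcal O$-coaction: $(\Delta\otimes\mathrm{id})\lambda=(\mathrm{id}\otimes\lambda)\lambda$ and $(\epsilon\otimes\mathrm{id})\lambda=\mathrm{id}$. 4. $(U(\mathfrak h_{Lie}),\blacktriangleleft,\lambda)$ is a braided commutative right-left Yetter–Drinfeld $\mathcal O$-module algebra. That is, writing $\lambda(a)=a_{[-1]}\otimes a_{[0]}$, besides 1 and 3 one has, for all $a,b\in U(\mathfrak h_{Lie})$ and $f\in\mathcal O$: $f_{(2)}(a\blacktriangleleft f_{(1)})_{[-1]}\otimes(a\blacktriangleleft f_{(1)})_{[0]}=a_{[-1]}f_{(1)}\otimes(a_{[0]}\blacktriangleleft f_{(2)})$; $\lambda(1)=1\otimes 1$ and $\lambda(ab)=b_{[-1]}a_{[-1]}\otimes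 a_{[0]}b_{[0]}$; and $(a\blacktriangleleft b_{[-1]})b_{[0]}=ba$. 5. The pairing, $\blacktriangleleft$ and $\lambda$ do not depend on the basis: if $\mathbf b'=(y'_1,\dots,y'_n)$ is another basis, $y'_j=\sum_iT^i_jy_i$, then there is a Hopf algebra isomorphism from the presentation of $\mathcal O$ in $\mathbf b'$ to that in $\mathbf b$ with $\mathcal G_{\mathbf b'}\mapsto T^{-1}\mathcal G_{\mathbf b}T$ and $\bar{\mathcal G}_{\mathbf b'}\mapsto T^{-1}\bar{\mathcal G}_{\mathbf b}T$, and it carries the pairing, the action and the map $\lambda$ built from $\mathbf b'$ to those built from $\mathbf b$. -/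

import Mathlib

open scoped TensorProduct

noncomputable section

/-! ### Hopf algebra structure on a universal enveloping algebra -/

namespace UniversalEnvelopingAlgebra

variable (R L : Type*) [CommRing R] [LieRing L] [LieAlgebra R L]

section
attribute [local instance 100] LieRing.ofAssociativeRing

variable {R L} in
/-- The algebra map extending a linear map which sends brackets to commutators. -/
def liftLinear {A : Type*} [Ring A] [Algebra R A] (f : L →ₗ[R] A)
    (hf : ∀ x y, f ⁅x, y⁆ = f x * f y - f y * f x) : UniversalEnvelopingAlgebra R L →ₐ[R] A :=
  lift R { f with map_lie' := fun {x y} => hf x y }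

variable {R L} in
lemma liftLinear_ι {A : Type*} [Ring A] [Algebra R A] (f : L →ₗ[R] A)
    (hf : ∀ x y, f ⁅x, y⁆ = f x * f y - f y * f x) (x : L) :
    liftLinear f hf (ι R x) = f x := by
  rw [liftLinear, lift_ι_apply]; rfl

variable {R L} in
lemma ι_lie (x y : L) : ι R ⁅x, y⁆ = ι R x * ι R y - ι R y * ι R x := by
  rw [LieHom.map_lie]; rfl

/-- The inclusion `L → U(L)` as a linear map. -/
def ιLin : L →ₗ[R] UniversalEnvelopingAlgebra R L := (ι R : L →ₗ⁅R⁆ _)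

variable {R L} in
lemma ιLin_apply (x : L) : ιLin R L x = ι R x := rfl

/-- The comultiplication, determined by `Δ(x) = x ⊗ 1 + 1 ⊗ x` for `x ∈ L`. -/
def comulHom : UniversalEnvelopingAlgebra R L →ₐ[R]
    UniversalEnvelopingAlgebra R L ⊗[R] UniversalEnvelopingAlgebra R L :=
  liftLinear
    ((TensorProduct.mk R (UniversalEnvelopingAlgebra R L)
        (UniversalEnvelopingAlgebra R L)).flip 1 ∘ₗ ιLin R L
      + TensorProduct.mk R (UniversalEnvelopingAlgebra R L)
        (UniversalEnvelopingAlgebra R L) 1 ∘ₗ ιLin R L)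
    (by
      intro x y
      simp only [LinearMap.add_apply, LinearMap.comp_apply, LinearMap.flip_apply,
        TensorProduct.mk_apply, ιLin_apply, ι_lie, TensorProduct.sub_tmul,
        TensorProduct.tmul_sub, mul_add, add_mul, Algebra.TensorProduct.tmul_mul_tmul, one_mul,
        mul_one]
      abel)

/-- The counit, determined by `ε(x) = 0` for `x ∈ L`. -/
def counitHom : UniversalEnvelopingAlgebra R L →ₐ[R] R := liftLinear 0 (by simp)

/-- The antipode as an algebra map to the opposite algebra, determined by `S(x) = -x`
for `x ∈ L`. -/
def antipodeHom : UniversalEnvelopingAlgebra R L →ₐ[R] (UniversalEnvelopingAlgebra R L)ᵐᵒᵖ :=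
  liftLinear (-((MulOpposite.opLinearEquiv R).toLinearMap ∘ₗ ιLin R L))
    (by
      intro x y
      simp only [LinearMap.neg_apply, LinearMap.comp_apply, ιLin_apply, ι_lie,
        LinearEquiv.coe_coe, MulOpposite.coe_opLinearEquiv, MulOpposite.op_sub,
        MulOpposite.op_mul, neg_mul_neg, neg_sub])

@[simp] lemma comulHom_ι (x : L) : comulHom R L (ι R x) = ι R x ⊗ₜ 1 + 1 ⊗ₜ ι R x := by
  rw [comulHom, liftLinear_ι]; rfl

@[simp] lemma counitHom_ι (x : L) : counitHom R L (ι R x) = 0 := by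
  rw [counitHom, liftLinear_ι]; rfl

@[simp] lemma antipodeHom_ι (x : L) : antipodeHom R L (ι R x) = -MulOpposite.op (ι R x) := by
  rw [antipodeHom, liftLinear_ι]; rfl

variable {R L}

lemma hom_ext_ι {A : Type*} [Ring A] [Algebra R A] {f g : UniversalEnvelopingAlgebra R L →ₐ[R] A}
    (hfg : ∀ x, f (ι R x) = g (ι R x)) : f = g := by
  apply hom_ext
  ext x
  exact hfg x

lemma mem_of_ι_mem (S : Subalgebra R (UniversalEnvelopingAlgebra R L))
    (hS : ∀ x, ι R x ∈ S) (a : UniversalEnvelopingAlgebra R L) : a ∈ S := by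
  let f : L →ₗ⁅R⁆ S :=
    { toFun := fun x => ⟨ι R x, hS x⟩
      map_add' := fun x y => by ext; simp
      map_smul' := fun c x => by ext; simp
      map_lie' := by
        intro x y
        ext
        simp [LieRing.of_associative_ring_bracket] }
  have h : S.val.comp (lift R f) = AlgHom.id R _ := by
    apply hom_ext_ι
    intro x
    simp only [AlgHom.comp_apply, lift_ι_apply]
    rfl
  have := DFunLike.congr_fun h a
  simp only [AlgHom.comp_apply, AlgHom.id_apply] at this
  rw [← this]
  exact (lift R f a).2

end

variable {R L}

instance : Bialgebra R (UniversalEnvelopingAlgebra R L) :=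
  Bialgebra.ofAlgHom (comulHom R L) (counitHom R L)
    (by
      apply hom_ext_ι
      intro x
      simp [-ι_apply, TensorProduct.add_tmul, TensorProduct.tmul_add,
        Algebra.TensorProduct.one_def, add_assoc])
    (by apply hom_ext_ι; intro x; simp [-ι_apply])
    (by apply hom_ext_ι; intro x; simp [-ι_apply])

lemma comul_apply (a : UniversalEnvelopingAlgebra R L) :
    Coalgebra.comul (R := R) a = comulHom R L a := rfl

lemma counit_apply (a : UniversalEnvelopingAlgebra R L) :
    Coalgebra.counit (R := R) a = counitHom R L a := rfl

variable (R L) in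
/-- The antipode as a linear map. -/
def antipodeMap : UniversalEnvelopingAlgebra R L →ₗ[R] UniversalEnvelopingAlgebra R L :=
  (MulOpposite.opLinearEquiv R).symm.toLinearMap ∘ₗ (antipodeHom R L).toLinearMap

lemma antipodeMap_mul (a b : UniversalEnvelopingAlgebra R L) :
    antipodeMap R L (a * b) = antipodeMap R L b * antipodeMap R L a := by
  simp [antipodeMap]

lemma antipodeMap_one : antipodeMap R L 1 = 1 := by simp [antipodeMap]

lemma antipodeMap_algebraMap (r : R) : antipodeMap R L (algebraMap R _ r) = algebraMap R _ r := by
  rw [Algebra.algebraMap_eq_smul_one, map_smul, antipodeMap_one]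

lemma antipodeMap_ι (x : L) : antipodeMap R L (ι R x) = -ι R x := by
  simp [antipodeMap, -ι_apply]

lemma antipode_left_mul (a b : UniversalEnvelopingAlgebra R L)
    (ha : LinearMap.mul' R _ ((antipodeMap R L).rTensor _ (comulHom R L a))
      = algebraMap R _ (counitHom R L a))
    (hb : LinearMap.mul' R _ ((antipodeMap R L).rTensor _ (comulHom R L b))
      = algebraMap R _ (counitHom R L b)) :
    LinearMap.mul' R _ ((antipodeMap R L).rTensor _ (comulHom R L (a * b)))
      = algebraMap R _ (counitHom R L (a * b)) := by
  have key : ∀ s t : UniversalEnvelopingAlgebra R L ⊗[R] UniversalEnvelopingAlgebra R L, ∀ r : R,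
      LinearMap.mul' R _ ((antipodeMap R L).rTensor _ s) = algebraMap R _ r →
      LinearMap.mul' R _ ((antipodeMap R L).rTensor _ (s * t))
        = r • LinearMap.mul' R _ ((antipodeMap R L).rTensor _ t) := by
    intro s t r hs
    induction t with
    | zero => simp
    | add t₁ t₂ h₁ h₂ => rw [mul_add, map_add, map_add, h₁, h₂, map_add, map_add, smul_add]
    | tmul u v =>
      have h2 : ∀ s : UniversalEnvelopingAlgebra R L ⊗[R] UniversalEnvelopingAlgebra R L,
          LinearMap.mul' R _ ((antipodeMap R L).rTensor _ (s * (u ⊗ₜ v)))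
            = antipodeMap R L u *
              LinearMap.mul' R _ ((antipodeMap R L).rTensor _ s) * v := by
        intro s
        induction s with
        | zero => simp
        | add s₁ s₂ h₁ h₂ => simp only [add_mul, map_add, h₁, h₂, mul_add]
        | tmul x y => simp [antipodeMap_mul, mul_assoc]
      rw [h2, hs, ← Algebra.commutes, Algebra.smul_def]
      simp [mul_assoc]
  rw [map_mul, key _ _ _ ha, hb, map_mul, map_mul, Algebra.smul_def]

lemma antipode_right_mul (a b : UniversalEnvelopingAlgebra R L)
    (ha : LinearMap.mul' R _ ((antipodeMap R L).lTensor _ (comulHom R L a))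
      = algebraMap R _ (counitHom R L a))
    (hb : LinearMap.mul' R _ ((antipodeMap R L).lTensor _ (comulHom R L b))
      = algebraMap R _ (counitHom R L b)) :
    LinearMap.mul' R _ ((antipodeMap R L).lTensor _ (comulHom R L (a * b)))
      = algebraMap R _ (counitHom R L (a * b)) := by
  have key : ∀ s t : UniversalEnvelopingAlgebra R L ⊗[R] UniversalEnvelopingAlgebra R L, ∀ r : R,
      LinearMap.mul' R _ ((antipodeMap R L).lTensor _ t) = algebraMap R _ r →
      LinearMap.mul' R _ ((antipodeMap R L).lTensor _ (s * t))
        = r • LinearMap.mul' R _ ((antipodeMap R L).lTensor _ s) := by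
    intro s t r ht
    induction s with
    | zero => simp
    | add t₁ t₂ h₁ h₂ => rw [add_mul, map_add, map_add, h₁, h₂, map_add, map_add, smul_add]
    | tmul u v =>
      have h2 : ∀ t : UniversalEnvelopingAlgebra R L ⊗[R] UniversalEnvelopingAlgebra R L,
          LinearMap.mul' R _ ((antipodeMap R L).lTensor _ ((u ⊗ₜ v) * t))
            = u * LinearMap.mul' R _ ((antipodeMap R L).lTensor _ t) * antipodeMap R L v := by
        intro t
        induction t with
        | zero => simp
        | add s₁ s₂ h₁ h₂ => simp only [add_mul, map_add, h₁, h₂, mul_add]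
        | tmul x y => simp [antipodeMap_mul, mul_assoc]
      rw [h2, ht, ← Algebra.commutes, Algebra.smul_def]
      simp [mul_assoc]
  rw [map_mul, key _ _ _ hb, ha, map_mul, map_mul, Algebra.smul_def]
  exact (Algebra.commutes _ _)

instance : HopfAlgebra R (UniversalEnvelopingAlgebra R L) where
  antipode := antipodeMap R L
  mul_antipode_rTensor_comul := by
    ext a
    refine mem_of_ι_mem
      { carrier := {a | LinearMap.mul' R _ ((antipodeMap R L).rTensor _ (comulHom R L a))
          = algebraMap R _ (counitHom R L a)}
        mul_mem' := fun {a b} ha hb => antipode_left_mul a b ha hb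
        add_mem' := fun {a b} ha hb => by
          simp only [Set.mem_ofPred_eq] at ha hb ⊢
          simp only [map_add, ha, hb]
        algebraMap_mem' := fun r => by
          simp [Algebra.TensorProduct.algebraMap_apply, antipodeMap_algebraMap] } ?_ a
    intro x
    show LinearMap.mul' R _ ((antipodeMap R L).rTensor _ (comulHom R L (ι R x)))
          = algebraMap R _ (counitHom R L (ι R x))
    simp only [comulHom_ι, counitHom_ι, map_add, LinearMap.rTensor_tmul, antipodeMap_ι,
      antipodeMap_one, LinearMap.mul'_apply, map_zero]
    simp
  mul_antipode_lTensor_comul := by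
    ext a
    refine mem_of_ι_mem
      { carrier := {a | LinearMap.mul' R _ ((antipodeMap R L).lTensor _ (comulHom R L a))
          = algebraMap R _ (counitHom R L a)}
        mul_mem' := fun {a b} ha hb => antipode_right_mul a b ha hb
        add_mem' := fun {a b} ha hb => by
          simp only [Set.mem_ofPred_eq] at ha hb ⊢
          simp only [map_add, ha, hb]
        algebraMap_mem' := fun r => by
          simp [Algebra.TensorProduct.algebraMap_apply, antipodeMap_one] } ?_ a
    intro x
    show LinearMap.mul' R _ ((antipodeMap R L).lTensor _ (comulHom R L (ι R x)))
          = algebraMap R _ (counitHom R L (ι R x))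
    simp only [comulHom_ι, counitHom_ι, map_add, LinearMap.lTensor_tmul, antipodeMap_ι,
      antipodeMap_one, LinearMap.mul'_apply, map_zero]
    simp

end UniversalEnvelopingAlgebra

/-! ### Right Leibniz algebras and their maximal Lie quotient -/

/-- A right Leibniz algebra: a vector space with a bilinear bracket such that every
`y ↦ [y, x]` is a derivation. -/
class RightLeibnizAlgebra (k 𝔥 : Type*) [Field k] [AddCommGroup 𝔥] [Module k 𝔥] where
  /-- The bracket `x, y ↦ [x, y]`. -/
  br : 𝔥 →ₗ[k] 𝔥 →ₗ[k] 𝔥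
  leibniz : ∀ x y z : 𝔥, br (br x y) z = br (br x z) y + br x (br y z)

namespace RightLeibnizAlgebra

variable (k 𝔥 : Type*) [Field k] [AddCommGroup 𝔥] [Module k 𝔥] [RightLeibnizAlgebra k 𝔥]

/-- The two-sided ideal generated by all `[x, x]`. -/
def squareIdeal : Submodule k 𝔥 :=
  sInf {I | (∀ x : 𝔥, br (k := k) x x ∈ I) ∧
    ∀ a x : 𝔥, x ∈ I → br (k := k) a x ∈ I ∧ br (k := k) x a ∈ I}

variable {k 𝔥}

lemma br_self_mem (x : 𝔥) : br (k := k) x x ∈ squareIdeal k 𝔥 := by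
  simp only [squareIdeal, Submodule.mem_sInf]
  exact fun I hI => hI.1 x

lemma br_mem_right (a : 𝔥) {x : 𝔥} (hx : x ∈ squareIdeal k 𝔥) :
    br (k := k) a x ∈ squareIdeal k 𝔥 := by
  simp only [squareIdeal, Submodule.mem_sInf] at hx ⊢
  exact fun I hI => (hI.2 a x (hx I hI)).1

lemma br_mem_left (a : 𝔥) {x : 𝔥} (hx : x ∈ squareIdeal k 𝔥) :
    br (k := k) x a ∈ squareIdeal k 𝔥 := by
  simp only [squareIdeal, Submodule.mem_sInf] at hx ⊢
  exact fun I hI => (hI.2 a x (hx I hI)).2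

variable (k 𝔥)

/-- The Lie algebra `𝔥_Lie`, the quotient of `𝔥` by the ideal generated by all `[x, x]`. -/
def LieQuotient : Type _ := 𝔥 ⧸ squareIdeal k 𝔥

namespace LieQuotient

instance : AddCommGroup (LieQuotient k 𝔥) :=
  inferInstanceAs (AddCommGroup (𝔥 ⧸ squareIdeal k 𝔥))

instance : Module k (LieQuotient k 𝔥) :=
  inferInstanceAs (Module k (𝔥 ⧸ squareIdeal k 𝔥))

/-- The quotient map `y ↦ ỹ`. -/
def mk : 𝔥 →ₗ[k] LieQuotient k 𝔥 := (squareIdeal k 𝔥).mkQ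

variable {k 𝔥} in
lemma mk_surjective : Function.Surjective (mk k 𝔥) := (squareIdeal k 𝔥).mkQ_surjective

variable {k 𝔥} in
lemma mk_eq_zero {x : 𝔥} : mk k 𝔥 x = 0 ↔ x ∈ squareIdeal k 𝔥 :=
  Submodule.Quotient.mk_eq_zero _

/-- The bracket induced on the quotient. -/
def bracket : LieQuotient k 𝔥 →ₗ[k] LieQuotient k 𝔥 →ₗ[k] LieQuotient k 𝔥 :=
  (squareIdeal k 𝔥).liftQ
    (LinearMap.flip ((squareIdeal k 𝔥).liftQ (((br (k := k)).compr₂ (mk k 𝔥)).flip) (by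
      intro x hx
      rw [LinearMap.mem_ker]
      ext a
      exact mk_eq_zero.2 (br_mem_right a hx))))
    (by
      intro x hx
      rw [LinearMap.mem_ker]
      ext a
      obtain ⟨a, rfl⟩ := mk_surjective a
      exact mk_eq_zero.2 (br_mem_left a hx))

variable {k 𝔥} in
lemma bracket_mk (x y : 𝔥) :
    bracket k 𝔥 (mk k 𝔥 x) (mk k 𝔥 y) = mk k 𝔥 (br (k := k) x y) := rfl

lemma bracket_self (x : LieQuotient k 𝔥) : bracket k 𝔥 x x = 0 := by
  obtain ⟨x, rfl⟩ := mk_surjective x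
  rw [bracket_mk]
  exact mk_eq_zero.2 (br_self_mem x)

instance : LieRing (LieQuotient k 𝔥) where
  bracket x y := bracket k 𝔥 x y
  add_lie x y z := by simp
  lie_add x y z := by simp
  lie_self x := bracket_self k 𝔥 x
  leibniz_lie x y z := by
    show bracket k 𝔥 x (bracket k 𝔥 y z) =
      bracket k 𝔥 (bracket k 𝔥 x y) z + bracket k 𝔥 y (bracket k 𝔥 x z)
    have skew : ∀ u v, bracket k 𝔥 u v = -bracket k 𝔥 v u := by
      intro u v
      have h := bracket_self k 𝔥 (u + v)
      simp only [map_add, LinearMap.add_apply, bracket_self, zero_add, add_zero] at h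
      exact eq_neg_of_add_eq_zero_right h
    rw [skew y (bracket k 𝔥 x z)]
    obtain ⟨x, rfl⟩ := mk_surjective x
    obtain ⟨y, rfl⟩ := mk_surjective y
    obtain ⟨z, rfl⟩ := mk_surjective z
    simp only [bracket_mk, leibniz x y z, map_add]
    abel

instance : LieAlgebra k (LieQuotient k 𝔥) where
  lie_smul c x y := (bracket k 𝔥 x).map_smul c y

end LieQuotient

/-- `U(𝔥_Lie)`. -/
abbrev UEnv : Type _ := UniversalEnvelopingAlgebra k (LieQuotient k 𝔥)

/-- The image of `y ∈ 𝔥` in `U(𝔥_Lie)`. -/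
def toUEnv (y : 𝔥) : UEnv k 𝔥 := UniversalEnvelopingAlgebra.ι k (LieQuotient.mk k 𝔥 y)

end RightLeibnizAlgebra

/-! ### The Hopf algebra of regular functions on the automorphism group -/

section OAut

variable {k L : Type*} [Field k] [AddCommGroup L] [Module k L] {n : ℕ}

/-- Structure constants `C^l_{ij}` of a bilinear product: `b_i · b_j = ∑_l C^l_{ij} b_l`. -/
def structConst (μ : L →ₗ[k] L →ₗ[k] L) (b : Module.Basis (Fin n) k L) (l i j : Fin n) : k :=
  b.repr (μ (b i) (b j)) l

/-- The equations `∑_{l,m} C^r_{lm} M^l_i M^m_j = ∑_l M^r_l C^l_{ij}`, saying that the matrix `M`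
respects the product with structure constants `C`. -/
def RespectsProduct {R : Type*} [CommRing R] [Algebra k R] (C : Fin n → Fin n → Fin n → k)
    (M : Matrix (Fin n) (Fin n) R) : Prop :=
  ∀ r i j, ∑ l, ∑ m, algebraMap k R (C r l m) * M l i * M m j =
    ∑ l, M r l * algebraMap k R (C l i j)

/-- The generic matrix `U`. -/
def genU (k : Type*) [Field k] (n : ℕ) :
    Matrix (Fin n) (Fin n) (MvPolynomial ((Fin n × Fin n) ⊕ (Fin n × Fin n)) k) :=
  .of fun i j => MvPolynomial.X (.inl (i, j))

/-- The second generic matrix `Ū`, to become the inverse of `U`. -/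
def genUbar (k : Type*) [Field k] (n : ℕ) :
    Matrix (Fin n) (Fin n) (MvPolynomial ((Fin n × Fin n) ⊕ (Fin n × Fin n)) k) :=
  .of fun i j => MvPolynomial.X (.inr (i, j))

/-- The ideal of the automorphism group scheme: it is generated by the entries of `U Ū - 1` and
`Ū U - 1` and by the equations saying that `U` respects the product. -/
def autIdeal (μ : L →ₗ[k] L →ₗ[k] L) (b : Module.Basis (Fin n) k L) :
    Ideal (MvPolynomial ((Fin n × Fin n) ⊕ (Fin n × Fin n)) k) :=
  Ideal.span
    (Set.range (fun p : Fin n × Fin n => (genU k n * genUbar k n - 1) p.1 p.2) ∪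
     Set.range (fun p : Fin n × Fin n => (genUbar k n * genU k n - 1) p.1 p.2) ∪
     Set.range (fun p : Fin n × Fin n × Fin n =>
      (∑ l, ∑ m, MvPolynomial.C (structConst μ b p.1 l m) * genU k n l p.2.1 * genU k n m p.2.2)
        - ∑ l, genU k n p.1 l * MvPolynomial.C (structConst μ b l p.2.1 p.2.2)))

/-- The algebra `O(Aut(L))` of regular functions on the affine algebraic group of automorphisms of
a finite-dimensional nonassociative algebra `(L, μ)`, in the coordinates given by the basis `b`:
the commutative algebra on generators `G^i_j`, `Ḡ^i_j` with relations `∑ G^i_l Ḡ^l_j = δ^i_j`,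
`∑ Ḡ^i_l G^l_j = δ^i_j` and `∑ C^r_{lm} G^l_i G^m_j = ∑ G^r_l C^l_{ij}`. -/
def OAut (μ : L →ₗ[k] L →ₗ[k] L) (b : Module.Basis (Fin n) k L) : Type _ :=
  MvPolynomial ((Fin n × Fin n) ⊕ (Fin n × Fin n)) k ⧸ autIdeal μ b

namespace OAut

variable (μ : L →ₗ[k] L →ₗ[k] L) (b : Module.Basis (Fin n) k L)

instance : CommRing (OAut μ b) :=
  inferInstanceAs
    (CommRing (MvPolynomial ((Fin n × Fin n) ⊕ (Fin n × Fin n)) k ⧸ autIdeal μ b))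

instance : Algebra k (OAut μ b) :=
  inferInstanceAs
    (Algebra k (MvPolynomial ((Fin n × Fin n) ⊕ (Fin n × Fin n)) k ⧸ autIdeal μ b))

/-- The quotient map from the polynomial algebra. -/
def mkHom : MvPolynomial ((Fin n × Fin n) ⊕ (Fin n × Fin n)) k →ₐ[k] OAut μ b :=
  Ideal.Quotient.mkₐ k (autIdeal μ b)

/-- The matrix of generators `G^i_j` (row `i`, column `j`): the matrix entries of an
automorphism `ψ`, so that `ψ(b_j) = ∑_i G^i_j(ψ) b_i`. -/
def G : Matrix (Fin n) (Fin n) (OAut μ b) := (genU k n).map (mkHom μ b)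

/-- The matrix of generators `Ḡ^i_j`: the matrix entries of the inverse automorphism. -/
def Gbar : Matrix (Fin n) (Fin n) (OAut μ b) := (genUbar k n).map (mkHom μ b)

lemma mkHom_eq_zero {x} (hx : x ∈ autIdeal μ b) : mkHom μ b x = 0 :=
  Ideal.Quotient.eq_zero_iff_mem.2 hx

lemma G_mul_Gbar : G μ b * Gbar μ b = 1 := by
  ext i j
  have h : mkHom μ b ((genU k n * genUbar k n - 1) i j) = 0 := mkHom_eq_zero μ b
    (Ideal.subset_span (Or.inl (Or.inl ⟨(i, j), rfl⟩)))
  rw [Matrix.sub_apply, map_sub, sub_eq_zero, Matrix.mul_apply, map_sum] at h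
  simp only [map_mul] at h
  rw [Matrix.mul_apply]
  refine h.trans ?_
  rw [Matrix.one_apply, Matrix.one_apply]
  split_ifs <;> simp

lemma Gbar_mul_G : Gbar μ b * G μ b = 1 := by
  ext i j
  have h : mkHom μ b ((genUbar k n * genU k n - 1) i j) = 0 := mkHom_eq_zero μ b
    (Ideal.subset_span (Or.inl (Or.inr ⟨(i, j), rfl⟩)))
  rw [Matrix.sub_apply, map_sub, sub_eq_zero, Matrix.mul_apply, map_sum] at h
  simp only [map_mul] at h
  rw [Matrix.mul_apply]
  refine h.trans ?_
  rw [Matrix.one_apply, Matrix.one_apply]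
  split_ifs <;> simp

lemma respects_G : RespectsProduct (structConst μ b) (G μ b) := by
  intro r i j
  have h := mkHom_eq_zero μ b (Ideal.subset_span (Or.inr ⟨(r, i, j), rfl⟩))
  rw [map_sub, sub_eq_zero] at h
  simp only [map_sum, map_mul] at h
  have hC : ∀ c : k, mkHom μ b (MvPolynomial.C c) = algebraMap k _ c := fun c =>
    (mkHom μ b).commutes c
  simp only [hC] at h
  exact h

variable {μ b}
variable {R : Type*} [CommRing R] [Algebra k R]

/-- Universal property: a pair of mutually inverse matrices respecting the product defines an
algebra map out of `O(Aut(L))`. -/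
def lift (M N : Matrix (Fin n) (Fin n) R) (h1 : M * N = 1) (h2 : N * M = 1)
    (h3 : RespectsProduct (structConst μ b) M) : OAut μ b →ₐ[k] R :=
  Ideal.Quotient.liftₐ (autIdeal μ b)
    (MvPolynomial.aeval (Sum.elim (fun p => M p.1 p.2) (fun p => N p.1 p.2)))
    (by
      intro a ha
      rw [← RingHom.mem_ker]
      revert a
      change autIdeal μ b ≤ _
      rw [autIdeal, Ideal.span_le]
      rintro x ((⟨⟨i, j⟩, rfl⟩ | ⟨⟨i, j⟩, rfl⟩) | ⟨⟨r, i, j⟩, rfl⟩)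
      · rw [SetLike.mem_coe, RingHom.mem_ker]
        have := congrFun (congrFun h1 i) j
        rw [Matrix.mul_apply] at this
        simp only [Matrix.sub_apply, Matrix.mul_apply, map_sub, map_sum, map_mul, genU, genUbar,
          Matrix.of_apply, MvPolynomial.aeval_X, Sum.elim_inl, Sum.elim_inr, this]
        rw [Matrix.one_apply, Matrix.one_apply]
        split_ifs <;> simp
      · rw [SetLike.mem_coe, RingHom.mem_ker]
        have := congrFun (congrFun h2 i) j
        rw [Matrix.mul_apply] at this
        simp only [Matrix.sub_apply, Matrix.mul_apply, map_sub, map_sum, map_mul, genU, genUbar,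
          Matrix.of_apply, MvPolynomial.aeval_X, Sum.elim_inl, Sum.elim_inr, this]
        rw [Matrix.one_apply, Matrix.one_apply]
        split_ifs <;> simp
      · rw [SetLike.mem_coe, RingHom.mem_ker]
        simp only [map_sub, map_sum, map_mul, genU, Matrix.of_apply, MvPolynomial.aeval_X,
          Sum.elim_inl, MvPolynomial.aeval_C]
        exact sub_eq_zero.2 (h3 r i j))

@[simp] lemma lift_G (M N : Matrix (Fin n) (Fin n) R) (h1 : M * N = 1) (h2 : N * M = 1)
    (h3 : RespectsProduct (structConst μ b) M) (i j : Fin n) :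
    lift M N h1 h2 h3 (G μ b i j) = M i j := by
  change MvPolynomial.aeval _ (genU k n i j) = _
  simp [genU]

@[simp] lemma lift_Gbar (M N : Matrix (Fin n) (Fin n) R) (h1 : M * N = 1) (h2 : N * M = 1)
    (h3 : RespectsProduct (structConst μ b) M) (i j : Fin n) :
    lift M N h1 h2 h3 (Gbar μ b i j) = N i j := by
  change MvPolynomial.aeval _ (genUbar k n i j) = _
  simp [genUbar]

lemma hom_ext {S : Type*} [Semiring S] [Algebra k S] {f g : OAut μ b →ₐ[k] S}
    (h1 : ∀ i j, f (G μ b i j) = g (G μ b i j))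
    (h2 : ∀ i j, f (Gbar μ b i j) = g (Gbar μ b i j)) : f = g := by
  apply Ideal.Quotient.algHom_ext
  apply MvPolynomial.algHom_ext
  rintro (⟨i, j⟩ | ⟨i, j⟩)
  · exact h1 i j
  · exact h2 i j

lemma respects_map {S : Type*} [CommRing S] [Algebra k S] {C : Fin n → Fin n → Fin n → k}
    {M : Matrix (Fin n) (Fin n) R} (hM : RespectsProduct C M) (f : R →ₐ[k] S) :
    RespectsProduct C (M.map f) := by
  intro r i j
  have := congrArg f (hM r i j)
  simpa [map_sum, map_mul] using this

lemma respects_one (C : Fin n → Fin n → Fin n → k) :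
    RespectsProduct C (1 : Matrix (Fin n) (Fin n) R) := by
  intro r i j
  simp [Matrix.one_apply]

lemma respects_mul {C : Fin n → Fin n → Fin n → k} {M N : Matrix (Fin n) (Fin n) R}
    (hM : RespectsProduct C M) (hN : RespectsProduct C N) : RespectsProduct C (M * N) := by
  intro r i j
  have e1 : ∀ l m, algebraMap k R (C r l m) * (M * N) l i * (M * N) m j =
      ∑ p, ∑ q, (algebraMap k R (C r l m) * M l p * M m q) * (N p i * N q j) := by
    intro l m
    rw [Matrix.mul_apply, Matrix.mul_apply, mul_assoc, Finset.sum_mul_sum, Finset.mul_sum]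
    refine Finset.sum_congr rfl fun p _ => ?_
    rw [Finset.mul_sum]
    refine Finset.sum_congr rfl fun q _ => ?_
    ring
  have e2 : ∑ l, ∑ m, algebraMap k R (C r l m) * (M * N) l i * (M * N) m j =
      ∑ p, ∑ q, (∑ l, ∑ m, algebraMap k R (C r l m) * M l p * M m q) * (N p i * N q j) := by
    simp only [e1, Finset.sum_mul]
    calc _ = ∑ l, ∑ p, ∑ m, ∑ q, (algebraMap k R (C r l m) * M l p * M m q) * (N p i * N q j) :=
          Finset.sum_congr rfl fun l _ => Finset.sum_comm
      _ = ∑ p, ∑ l, ∑ m, ∑ q, (algebraMap k R (C r l m) * M l p * M m q) * (N p i * N q j) :=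
          Finset.sum_comm
      _ = ∑ p, ∑ l, ∑ q, ∑ m, (algebraMap k R (C r l m) * M l p * M m q) * (N p i * N q j) :=
          Finset.sum_congr rfl fun p _ => Finset.sum_congr rfl fun l _ => Finset.sum_comm
      _ = _ := Finset.sum_congr rfl fun p _ => Finset.sum_comm
  rw [e2]
  simp only [hM r _ _, Finset.sum_mul]
  calc _ = ∑ p, ∑ s, ∑ q, M r s * algebraMap k R (C s p q) * (N p i * N q j) :=
        Finset.sum_congr rfl fun p _ => Finset.sum_comm
    _ = ∑ s, ∑ p, ∑ q, M r s * algebraMap k R (C s p q) * (N p i * N q j) := Finset.sum_comm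
    _ = ∑ s, M r s * ∑ p, ∑ q, algebraMap k R (C s p q) * N p i * N q j := by
        refine Finset.sum_congr rfl fun s _ => ?_
        simp only [Finset.mul_sum]
        refine Finset.sum_congr rfl fun p _ => Finset.sum_congr rfl fun q _ => ?_
        ring
    _ = ∑ s, M r s * ∑ t, N s t * algebraMap k R (C t i j) :=
        Finset.sum_congr rfl fun s _ => by rw [hN s i j]
    _ = ∑ t, (M * N) r t * algebraMap k R (C t i j) := by
        simp only [Matrix.mul_apply, Finset.sum_mul, Finset.mul_sum]
        rw [Finset.sum_comm]
        refine Finset.sum_congr rfl fun p _ => Finset.sum_congr rfl fun q _ => ?_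
        ring

lemma respects_inv {C : Fin n → Fin n → Fin n → k} {M N : Matrix (Fin n) (Fin n) R}
    (h1 : M * N = 1) (h2 : N * M = 1) (hM : RespectsProduct C M) : RespectsProduct C N := by
  have mn : ∀ x y, ∑ z, M x z * N z y = if x = y then 1 else 0 := fun x y => by
    rw [← Matrix.mul_apply, h1, Matrix.one_apply]
  have nm : ∀ x y, ∑ z, N x z * M z y = if x = y then 1 else 0 := fun x y => by
    rw [← Matrix.mul_apply, h2, Matrix.one_apply]
  intro r i j
  have key : ∀ s, ∑ t, M s t * (∑ p, ∑ q, algebraMap k R (C t p q) * N p i * N q j) =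
      algebraMap k R (C s i j) := by
    intro s
    calc _ = ∑ p, ∑ q, (∑ t, M s t * algebraMap k R (C t p q)) * (N p i * N q j) := by
          simp only [Finset.mul_sum, Finset.sum_mul]
          rw [Finset.sum_comm]
          refine Finset.sum_congr rfl fun p _ => ?_
          rw [Finset.sum_comm]
          refine Finset.sum_congr rfl fun q _ => Finset.sum_congr rfl fun t _ => ?_
          ring
      _ = ∑ p, ∑ q, (∑ l, ∑ m, algebraMap k R (C s l m) * M l p * M m q) * (N p i * N q j) := by
          simp only [hM s _ _]
      _ = ∑ l, ∑ m, algebraMap k R (C s l m) * ((∑ p, M l p * N p i) * (∑ q, M m q * N q j)) := by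
          simp only [Finset.mul_sum, Finset.sum_mul]
          calc _ = ∑ p, ∑ l, ∑ q, ∑ m,
                algebraMap k R (C s l m) * M l p * M m q * (N p i * N q j) :=
                Finset.sum_congr rfl fun p _ => Finset.sum_comm
            _ = ∑ l, ∑ p, ∑ q, ∑ m,
                algebraMap k R (C s l m) * M l p * M m q * (N p i * N q j) := Finset.sum_comm
            _ = ∑ l, ∑ p, ∑ m, ∑ q,
                algebraMap k R (C s l m) * M l p * M m q * (N p i * N q j) :=
                Finset.sum_congr rfl fun l _ => Finset.sum_congr rfl fun p _ => Finset.sum_comm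
            _ = ∑ l, ∑ m, ∑ p, ∑ q,
                algebraMap k R (C s l m) * M l p * M m q * (N p i * N q j) :=
                Finset.sum_congr rfl fun l _ => Finset.sum_comm
            _ = _ := by
                refine Finset.sum_congr rfl fun l _ => Finset.sum_congr rfl fun m _ => ?_
                rw [Finset.sum_comm]
                refine Finset.sum_congr rfl fun p _ => Finset.sum_congr rfl fun q _ => ?_
                ring
      _ = _ := by simp [mn]
  calc _ = ∑ t, (if r = t then 1 else 0) *
        (∑ p, ∑ q, algebraMap k R (C t p q) * N p i * N q j) := by simp
    _ = ∑ t, (∑ s, N r s * M s t) * (∑ p, ∑ q, algebraMap k R (C t p q) * N p i * N q j) := by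
        simp only [nm]
    _ = ∑ s, N r s * ∑ t, M s t * (∑ p, ∑ q, algebraMap k R (C t p q) * N p i * N q j) := by
        simp only [Finset.sum_mul]
        rw [Finset.sum_comm]
        refine Finset.sum_congr rfl fun s _ => ?_
        rw [Finset.mul_sum]
        refine Finset.sum_congr rfl fun t _ => ?_
        rw [mul_assoc]
    _ = _ := by simp only [key]

variable (μ b)

/-- The matrix `G` in the left tensor factor. -/
def GLeft : Matrix (Fin n) (Fin n) (OAut μ b ⊗[k] OAut μ b) :=
  (G μ b).map (Algebra.TensorProduct.includeLeft : OAut μ b →ₐ[k] OAut μ b ⊗[k] OAut μ b)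

/-- The matrix `G` in the right tensor factor. -/
def GRight : Matrix (Fin n) (Fin n) (OAut μ b ⊗[k] OAut μ b) :=
  (G μ b).map (Algebra.TensorProduct.includeRight : OAut μ b →ₐ[k] OAut μ b ⊗[k] OAut μ b)

/-- The matrix `Ḡ` in the left tensor factor. -/
def GbarLeft : Matrix (Fin n) (Fin n) (OAut μ b ⊗[k] OAut μ b) :=
  (Gbar μ b).map (Algebra.TensorProduct.includeLeft : OAut μ b →ₐ[k] OAut μ b ⊗[k] OAut μ b)

/-- The matrix `Ḡ` in the right tensor factor. -/
def GbarRight : Matrix (Fin n) (Fin n) (OAut μ b ⊗[k] OAut μ b) :=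
  (Gbar μ b).map (Algebra.TensorProduct.includeRight : OAut μ b →ₐ[k] OAut μ b ⊗[k] OAut μ b)

lemma map_mul_eq_one {S : Type*} [CommRing S] [Algebra k S] {M N : Matrix (Fin n) (Fin n) R}
    (h : M * N = 1) (f : R →ₐ[k] S) : M.map f * N.map f = 1 := by
  rw [← Matrix.map_mul, h, Matrix.map_one f (map_zero f) (map_one f)]

/-- The comultiplication, determined by `Δ(G^i_j) = ∑_l G^i_l ⊗ G^l_j` and
`Δ(Ḡ^i_j) = ∑_l Ḡ^l_j ⊗ Ḡ^i_l`. -/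
def comulHom : OAut μ b →ₐ[k] OAut μ b ⊗[k] OAut μ b :=
  lift (GLeft μ b * GRight μ b) (GbarRight μ b * GbarLeft μ b)
    (by
      rw [Matrix.mul_assoc, ← Matrix.mul_assoc (GRight μ b),
        show GRight μ b * GbarRight μ b = 1 from map_mul_eq_one (G_mul_Gbar μ b) _, Matrix.one_mul]
      exact map_mul_eq_one (G_mul_Gbar μ b) _)
    (by
      rw [Matrix.mul_assoc, ← Matrix.mul_assoc (GbarLeft μ b),
        show GbarLeft μ b * GLeft μ b = 1 from map_mul_eq_one (Gbar_mul_G μ b) _, Matrix.one_mul]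
      exact map_mul_eq_one (Gbar_mul_G μ b) _)
    (respects_mul (respects_map (respects_G μ b) _) (respects_map (respects_G μ b) _))

/-- The counit, determined by `ε(G^i_j) = ε(Ḡ^i_j) = δ^i_j`. -/
def counitHom : OAut μ b →ₐ[k] k :=
  lift 1 1 (Matrix.one_mul _) (Matrix.one_mul _) (respects_one _)

/-- The antipode, determined by `S(G^i_j) = Ḡ^i_j` and `S(Ḡ^i_j) = G^i_j`. -/
def antipodeHom : OAut μ b →ₐ[k] OAut μ b :=
  lift (Gbar μ b) (G μ b) (Gbar_mul_G μ b) (G_mul_Gbar μ b)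
    (respects_inv (G_mul_Gbar μ b) (Gbar_mul_G μ b) (respects_G μ b))

@[simp] lemma comulHom_G (i j : Fin n) :
    comulHom μ b (G μ b i j) = ∑ l, G μ b i l ⊗ₜ G μ b l j := by
  rw [comulHom, lift_G, Matrix.mul_apply]
  simp [GLeft, GRight]

@[simp] lemma comulHom_Gbar (i j : Fin n) :
    comulHom μ b (Gbar μ b i j) = ∑ l, Gbar μ b l j ⊗ₜ Gbar μ b i l := by
  rw [comulHom, lift_Gbar, Matrix.mul_apply]
  simp [GbarLeft, GbarRight]

@[simp] lemma counitHom_G (i j : Fin n) :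
    counitHom μ b (G μ b i j) = if i = j then 1 else 0 := by
  rw [counitHom, lift_G, Matrix.one_apply]

@[simp] lemma counitHom_Gbar (i j : Fin n) :
    counitHom μ b (Gbar μ b i j) = if i = j then 1 else 0 := by
  rw [counitHom, lift_Gbar, Matrix.one_apply]

@[simp] lemma antipodeHom_G (i j : Fin n) : antipodeHom μ b (G μ b i j) = Gbar μ b i j :=
  lift_G ..

@[simp] lemma antipodeHom_Gbar (i j : Fin n) : antipodeHom μ b (Gbar μ b i j) = G μ b i j :=
  lift_Gbar ..

instance : Bialgebra k (OAut μ b) :=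
  Bialgebra.ofAlgHom (comulHom μ b) (counitHom μ b)
    (by
      apply hom_ext
      · intro i j
        simp [TensorProduct.sum_tmul, TensorProduct.tmul_sum]
        rw [Finset.sum_comm]
      · intro i j
        simp [TensorProduct.sum_tmul, TensorProduct.tmul_sum]
        rw [Finset.sum_comm])
    (by
      apply hom_ext <;> intro i j <;> simp [TensorProduct.ite_tmul])
    (by
      apply hom_ext <;> intro i j <;> simp [TensorProduct.tmul_ite])

instance : HopfAlgebra k (OAut μ b) :=
  HopfAlgebra.ofAlgHom (antipodeHom μ b)
    (by
      apply hom_ext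
      · intro i j
        have := congrFun (congrFun (Gbar_mul_G μ b) i) j
        rw [Matrix.mul_apply, Matrix.one_apply] at this
        change Algebra.TensorProduct.lift _ _ (fun _ _ => Commute.all _ _) (comulHom μ b _) =
          algebraMap _ _ (counitHom μ b _)
        simp [this]
      · intro i j
        have := congrFun (congrFun (Gbar_mul_G μ b) i) j
        rw [Matrix.mul_apply, Matrix.one_apply] at this
        change Algebra.TensorProduct.lift _ _ (fun _ _ => Commute.all _ _) (comulHom μ b _) =
          algebraMap _ _ (counitHom μ b _)
        simp [mul_comm (G μ b _ _), this])
    (by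
      apply hom_ext
      · intro i j
        have := congrFun (congrFun (G_mul_Gbar μ b) i) j
        rw [Matrix.mul_apply, Matrix.one_apply] at this
        change Algebra.TensorProduct.lift _ _ (fun _ _ => Commute.all _ _) (comulHom μ b _) =
          algebraMap _ _ (counitHom μ b _)
        simp [this]
      · intro i j
        have := congrFun (congrFun (G_mul_Gbar μ b) i) j
        rw [Matrix.mul_apply, Matrix.one_apply] at this
        change Algebra.TensorProduct.lift _ _ (fun _ _ => Commute.all _ _) (comulHom μ b _) =
          algebraMap _ _ (counitHom μ b _)
        simp [mul_comm (Gbar μ b _ _), this])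

end OAut

end OAut

/-! ### Hopf pairings, Hopf actions, smash products, Yetter–Drinfeld module algebras -/

section YetterDrinfeld

open TensorProduct Coalgebra

variable {k H A : Type*} [Field k] [Ring H] [HopfAlgebra k H]

/-- `p : B ⊗ H → k` is a Hopf pairing; pairings extend to tensor squares componentwise,
`⟨b ⊗ b', h ⊗ h'⟩ = ⟨b, h⟩⟨b', h'⟩`. -/
structure IsHopfPairing {B : Type*} [Ring B] [HopfAlgebra k B] (p : B →ₗ[k] H →ₗ[k] k) :
    Prop where
  /-- `⟨b, g h⟩ = ⟨Δ b, g ⊗ h⟩` -/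
  mul_right : ∀ (b : B) (g h : H),
    p b (g * h) = dualDistrib k H H (map p p (comul b)) (g ⊗ₜ h)
  /-- `⟨b, 1⟩ = ε(b)` -/
  one_right : ∀ b : B, p b 1 = counit b
  /-- `⟨b c, h⟩ = ⟨b ⊗ c, Δ h⟩` -/
  mul_left : ∀ (b c : B) (h : H),
    p (b * c) h = dualDistrib k H H (p b ⊗ₜ p c) (comul h)
  /-- `⟨1, h⟩ = ε(h)` -/
  one_left : ∀ h : H, p 1 h = counit h

/-- The map `u ◁ f = ⟨u₍₁₎, f⟩ u₍₂₎` induced by a pairing; `pairingAction p u f` is `u ◁ f`. -/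
def pairingAction {B : Type*} [Ring B] [HopfAlgebra k B] (p : B →ₗ[k] H →ₗ[k] k) :
    B →ₗ[k] H →ₗ[k] B :=
  LinearMap.flip
    { toFun := fun f => (TensorProduct.lid k B).toLinearMap ∘ₗ (p.flip f).rTensor B ∘ₗ comul
      map_add' := fun f g => by
        rw [map_add, LinearMap.rTensor_add, LinearMap.add_comp, LinearMap.comp_add]
      map_smul' := fun c f => by
        rw [map_smul, LinearMap.rTensor_smul, LinearMap.smul_comp, LinearMap.comp_smul,
          RingHom.id_apply] }

lemma pairingAction_apply {B : Type*} [Ring B] [HopfAlgebra k B] (p : B →ₗ[k] H →ₗ[k] k)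
    (u : B) (f : H) {ι : Type*} (s : Finset ι) (x y : ι → B)
    (hu : comul (R := k) u = ∑ i ∈ s, x i ⊗ₜ y i) :
    pairingAction p u f = ∑ i ∈ s, p (x i) f • y i := by
  simp [pairingAction, hu]

variable [Ring A] [Algebra k A]

/-- `act a h = a ◁ h` is a right Hopf action of `H` on the algebra `A`, that is, `A` is a right
`H`-module algebra. -/
structure IsRightHopfAction (act : A →ₗ[k] H →ₗ[k] A) : Prop where
  /-- `a ◁ 1 = a` -/
  act_one : ∀ a : A, act a 1 = a
  /-- `a ◁ (f g) = (a ◁ f) ◁ g` -/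
  act_mul : ∀ (a : A) (f g : H), act a (f * g) = act (act a f) g
  /-- `(a b) ◁ h = (a ◁ h₍₁₎)(b ◁ h₍₂₎)` -/
  mul_act : ∀ (a b : A) (h : H),
    act (a * b) h = TensorProduct.lift ((LinearMap.mul k A).compl₁₂ (act a) (act b)) (comul h)
  /-- `1 ◁ h = ε(h) 1` -/
  one_act : ∀ h : H, act 1 h = algebraMap k A (counit h)

/-- The multiplication of the smash product `H ♯ A` on `H ⊗ A`:
`(h ♯ a)(f ♯ b) = h f₍₁₎ ♯ (a ◁ f₍₂₎) b`. -/
def smashMul (act : A →ₗ[k] H →ₗ[k] A) : H ⊗[k] A →ₗ[k] H ⊗[k] A →ₗ[k] H ⊗[k] A :=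
  TensorProduct.lift
    (((TensorProduct.mapBilinear (.id k) H (H ⊗[k] A) H A).compl₁₂ (LinearMap.mul k H)
        -- `a` is sent to the map `f ⊗ b ↦ (a ◁ f) b`
        (TensorProduct.uncurry (.id k) H A A ∘ₗ LinearMap.llcomp k H A (A →ₗ[k] A)
          (LinearMap.mul k A) ∘ₗ act)).compr₂
      (LinearMap.lcomp k (H ⊗[k] A)
        ((TensorProduct.assoc k H H A).toLinearMap ∘ₗ (comul (R := k) (A := H)).rTensor A)))

lemma smashMul_tmul (act : A →ₗ[k] H →ₗ[k] A) (h f : H) (a b : A) {ι : Type*} (s : Finset ι)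
    (x y : ι → H) (hf : comul (R := k) f = ∑ i ∈ s, x i ⊗ₜ y i) :
    smashMul act (h ⊗ₜ a) (f ⊗ₜ b) = ∑ i ∈ s, (h * x i) ⊗ₜ (act a (y i) * b) := by
  simp [smashMul, hf, TensorProduct.sum_tmul]

/-- `H ♯ A` is an associative algebra with unit `1 ♯ 1`. -/
structure IsSmashProductAlgebra (act : A →ₗ[k] H →ₗ[k] A) : Prop where
  mul_assoc : ∀ x y z : H ⊗[k] A,
    smashMul act (smashMul act x y) z = smashMul act x (smashMul act y z)
  one_mul : ∀ x : H ⊗[k] A, smashMul act (1 ⊗ₜ 1) x = x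
  mul_one : ∀ x : H ⊗[k] A, smashMul act x (1 ⊗ₜ 1) = x

/-- `lam : A → H ⊗ A` is a unital antimultiplicative map to the smash product `H ♯ A`. -/
structure IsUnitalAntimultiplicative (act : A →ₗ[k] H →ₗ[k] A) (lam : A →ₗ[k] H ⊗[k] A) :
    Prop where
  map_one : lam 1 = 1 ⊗ₜ 1
  map_mul : ∀ v z : A, lam (v * z) = smashMul act (lam z) (lam v)

/-- `lam : A → H ⊗ A` is a (coassociative, counital) left `H`-coaction. -/
structure IsLeftCoaction (lam : A →ₗ[k] H ⊗[k] A) : Prop where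
  /-- `(Δ ⊗ id) ∘ λ = (id ⊗ λ) ∘ λ` -/
  coassoc : ∀ a : A,
    TensorProduct.assoc k H H A ((comul (R := k) (A := H)).rTensor A (lam a)) =
      lam.lTensor H (lam a)
  /-- `(ε ⊗ id) ∘ λ = id` -/
  counit : ∀ a : A,
    TensorProduct.lid k A ((counit (R := k) (A := H)).rTensor A (lam a)) = a

/-- `(A, ◁, λ)` is a right-left Yetter–Drinfeld `H`-module algebra. -/
structure IsYetterDrinfeldModuleAlgebra (act : A →ₗ[k] H →ₗ[k] A) (lam : A →ₗ[k] H ⊗[k] A) :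
    Prop where
  /-- `A` is a right `H`-module algebra. -/
  action : IsRightHopfAction act
  coaction : IsLeftCoaction lam
  /-- The Yetter–Drinfeld compatibility
  `f₍₂₎ (a ◁ f₍₁₎)₍₋₁₎ ⊗ (a ◁ f₍₁₎)₍₀₎ = a₍₋₁₎ f₍₁₎ ⊗ (a₍₀₎ ◁ f₍₂₎)`. -/
  compat : ∀ (a : A) (f : H),
    TensorProduct.lift
        ((LinearMap.rTensorHom A ∘ₗ LinearMap.mul k H).flip ∘ₗ lam ∘ₗ act a) (comul f) =
      TensorProduct.lift
        (((TensorProduct.mapBilinear (.id k) H A H A).compl₁₂ (LinearMap.mul k H).flip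
          act.flip).compr₂ (LinearMap.applyₗ (lam a))) (comul f)
  /-- `λ(1) = 1 ⊗ 1` -/
  lam_one : lam 1 = 1 ⊗ₜ 1
  /-- `A` is an `Hᵒᵖ`-comodule algebra: `λ(a b) = b₍₋₁₎ a₍₋₁₎ ⊗ a₍₀₎ b₍₀₎`. -/
  lam_mul : ∀ a b : A,
    lam (a * b) = TensorProduct.map₂ (LinearMap.mul k H).flip (LinearMap.mul k A) (lam a) (lam b)

/-- Braided commutativity: `(a ◁ b₍₋₁₎) b₍₀₎ = b a`. -/
def IsBraidedCommutative (act : A →ₗ[k] H →ₗ[k] A) (lam : A →ₗ[k] H ⊗[k] A) : Prop :=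
  ∀ a b : A, TensorProduct.lift (LinearMap.mul k A ∘ₗ act a) (lam b) = b * a

end YetterDrinfeld

/-! ### The canonical pairing and the canonical coaction in a basis -/

namespace RightLeibnizAlgebra

variable {k 𝔥 : Type*} [Field k] [AddCommGroup 𝔥] [Module k 𝔥] [RightLeibnizAlgebra k 𝔥] {n : ℕ}

/-- The Hopf algebra `O(Aut(𝔥))` with the generators belonging to the basis `b`. -/
abbrev OAutL (b : Module.Basis (Fin n) k 𝔥) : Type _ := OAut (br (k := k) (𝔥 := 𝔥)) b

/-- `p` is a Hopf pairing of `U(𝔥_Lie)` and `O(Aut(𝔥))` with `⟨ỹ_l, G^i_j⟩ = -C^i_{jl}`. -/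
structure IsCanonicalPairing (b : Module.Basis (Fin n) k 𝔥)
    (p : UEnv k 𝔥 →ₗ[k] OAutL b →ₗ[k] k) : Prop where
  hopf : IsHopfPairing p
  apply_G : ∀ i j l : Fin n,
    p (toUEnv k 𝔥 (b l)) (OAut.G br b i j) = -structConst br b i j l

/-- `lam` is a unital antimultiplicative map `U(𝔥_Lie) → O(Aut(𝔥)) ♯ U(𝔥_Lie)` with
`λ(ỹ_j) = ∑_i Ḡ^i_j ♯ ỹ_i`. -/
structure IsCanonicalCoaction (b : Module.Basis (Fin n) k 𝔥)
    (act : UEnv k 𝔥 →ₗ[k] OAutL b →ₗ[k] UEnv k 𝔥)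
    (lam : UEnv k 𝔥 →ₗ[k] OAutL b ⊗[k] UEnv k 𝔥) : Prop where
  antimul : IsUnitalAntimultiplicative act lam
  apply_gen : ∀ j : Fin n,
    lam (toUEnv k 𝔥 (b j)) = ∑ i, OAut.Gbar br b i j ⊗ₜ toUEnv k 𝔥 (b i)

end RightLeibnizAlgebra

end

/-!
Write `U = U(𝔥_Lie)`, `O = O(Aut(𝔥))`. The proof rests on two observations.

*The pairing is given by tangent vectors.* By the Leibniz identity `-[·, x]` is a derivation of `𝔥`,
that is, a tangent vector of `Aut(𝔥)` at the identity: `1 - ε [·, x]` is an automorphism over the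
dual numbers, and its `ε`-part is a linear form on `O` satisfying the Leibniz rule at the counit
(`OAut.tangent`). A second use of the Leibniz identity shows that `x ↦ -[·, x]` factors through
`𝔥_Lie` and takes brackets to convolution commutators (`lieTangent_lie`). It therefore extends to an
algebra map from `U` to the convolution algebra of `O`, which is the pairing. Uniqueness holds
because the elements `ỹ` are primitive, hence must pair with `O` by such tangent vectors, and these
are determined by their values on the `G^i_j` (`OAut.IsPointDerivation.ext`). That a Hopf pairing
induces a Hopf action, and a Hopf action a smash product, is general.

*The coaction is multiplicative for the ordinary tensor product.* Since `O` is commutative and `Ḡ`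
respects the bracket, `y_j ↦ ∑ Ḡ^i_j ⊗ ỹ_i` takes brackets to commutators in the algebra `O ⊗ U`
(`genericInverse_br`), and so extends to an algebra map `λ : U → O ⊗ U` (`coactionHom`). All other
properties of `λ` then hold on subalgebras of `U`, so it is enough to check them on the `ỹ_j`:

* coassociativity and counitality compare algebra maps;
* braided commutativity with `ỹ_l` says `∑_c (a ◁ Ḡ^c_l) ỹ_c = ỹ_l a`
  (`IsCanonicalPairing.sum_action_Gbar_mul`), which for `a = ỹ_j` is the definition of the bracket
  of `U`; it also gives `λ(v z) = λ(z) λ(v)` in the smash product for `v = ỹ_l` and all `z`;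
* the Yetter–Drinfeld condition at `ỹ_j` says that the invariant vector field
  `f ↦ ⟨ỹ_j, f₍₁₎⟩ f₍₂₎` equals `∑_a Ḡ^a_j f₍₁₎ ⟨ỹ_a, f₍₂₎⟩`
  (`IsCanonicalPairing.vectorFieldLeft_apply_eq_sum`); both sides are derivations of `O`, and on the
  generators the equation states that `G` and `Ḡ` respect the bracket.

For another basis, conjugation by the transition matrix is an isomorphism of the two presentations
of `O` (`OAut.changeBasis`). Pulling back the pairing along it gives a canonical pairing in the new
basis, so uniqueness finishes the comparison, while the two coactions are algebra maps that agree
on generators.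
-/

noncomputable section

/-! ### Hopf pairings, Hopf actions and smash products in Sweedler notation -/

section HopfPairing

open TensorProduct Coalgebra

variable {k H A B : Type*} [Field k] [Ring H] [HopfAlgebra k H] [Ring B] [HopfAlgebra k B]
  [Ring A] [Algebra k A]

/-- The Sweedler representation `Δ(1) = 1 ⊗ 1`. -/
@[simps]
def Coalgebra.Repr.one : Repr k (1 : H) Unit where
  index := {()}
  left _ := 1
  right _ := 1
  eq := by simp [Algebra.TensorProduct.one_def]

/-- Coassociativity in Sweedler notation, evaluated by a linear map. -/
lemma Coalgebra.sum_coassoc {M C : Type*} [AddCommGroup M] [Module k M] [AddCommGroup C]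
    [Module k C] [Coalgebra k C] (φ : C ⊗[k] (C ⊗[k] C) →ₗ[k] M) {ι : Type*} {κ μ : ι → Type*}
    {a : C} (r : Repr k a ι)
    (s : ∀ i, Repr k (r.left i) (κ i)) (t : ∀ i, Repr k (r.right i) (μ i)) :
    ∑ i ∈ r.index, ∑ j ∈ (s i).index, φ ((s i).left j ⊗ₜ ((s i).right j ⊗ₜ r.right i)) =
      ∑ i ∈ r.index, ∑ j ∈ (t i).index, φ (r.left i ⊗ₜ ((t i).left j ⊗ₜ (t i).right j)) := by
  simpa using congrArg φ (sum_tmul_tmul_eq r s t)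

lemma dualDistrib_comul {ι : Type*} (φ ψ : H →ₗ[k] k) {h : H} (r : Repr k h ι) :
    dualDistrib k H H (φ ⊗ₜ ψ) (comul h) = ∑ i ∈ r.index, φ (r.left i) * ψ (r.right i) := by
  rw [← r.eq]
  simp

lemma dualDistrib_map_comul {ι : Type*} (p : B →ₗ[k] H →ₗ[k] k) {b : B} (r : Repr k b ι)
    (g h : H) : dualDistrib k H H (TensorProduct.map p p (comul b)) (g ⊗ₜ h) =
      ∑ i ∈ r.index, p (r.left i) g * p (r.right i) h := by
  rw [← r.eq]
  simp

lemma IsHopfPairing.mul_right_apply {p : B →ₗ[k] H →ₗ[k] k} (hp : IsHopfPairing p) {ι : Type*}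
    {b : B} (r : Repr k b ι) (g h : H) :
    p b (g * h) = ∑ i ∈ r.index, p (r.left i) g * p (r.right i) h := by
  rw [hp.mul_right, dualDistrib_map_comul p r]

lemma IsHopfPairing.mul_left_apply {p : B →ₗ[k] H →ₗ[k] k} (hp : IsHopfPairing p) {ι : Type*}
    (b c : B) {h : H} (r : Repr k h ι) :
    p (b * c) h = ∑ i ∈ r.index, p b (r.left i) * p c (r.right i) := by
  rw [hp.mul_left, dualDistrib_comul _ _ r]

lemma pairingAction_repr (p : B →ₗ[k] H →ₗ[k] k) {ι : Type*} {u : B} (r : Repr k u ι) (f : H) :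
    pairingAction p u f = ∑ i ∈ r.index, p (r.left i) f • r.right i :=
  pairingAction_apply p u f _ _ _ r.eq.symm

lemma IsRightHopfAction.mul_act_repr {act : A →ₗ[k] H →ₗ[k] A} (h : IsRightHopfAction act)
    {ι : Type*} (a b : A) {f : H} (r : Repr k f ι) :
    act (a * b) f = ∑ i ∈ r.index, act a (r.left i) * act b (r.right i) := by
  rw [h.mul_act, ← r.eq]
  simp

lemma smashMul_repr (act : A →ₗ[k] H →ₗ[k] A) (h : H) (a b : A) {f : H} {ι : Type*}
    (r : Repr k f ι) :
    smashMul act (h ⊗ₜ a) (f ⊗ₜ b) =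
      ∑ i ∈ r.index, (h * r.left i) ⊗ₜ (act a (r.right i) * b) :=
  smashMul_tmul act h f a b _ _ _ r.eq.symm

/-- The action `u ◁ f = ⟨u₍₁₎, f⟩ u₍₂₎` of any Hopf pairing is a Hopf action. -/
theorem IsHopfPairing.isRightHopfAction {p : B →ₗ[k] H →ₗ[k] k} (hp : IsHopfPairing p) :
    IsRightHopfAction (pairingAction p) where
  act_one u := by
    rw [pairingAction_repr p (ℛ k u)]
    simp only [hp.one_right]
    exact sum_counit_smul _
  act_mul u f g := by
    have key := sum_coassoc ((TensorProduct.lid k B).toLinearMap ∘ₗ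
      TensorProduct.map (p.flip f) ((TensorProduct.lid k B).toLinearMap ∘ₗ
        TensorProduct.map (p.flip g) .id)) (ℛ k u) (fun i => ℛ k _) (fun i => ℛ k _)
    simp only [LinearMap.comp_apply, TensorProduct.map_tmul, LinearMap.flip_apply,
      LinearEquiv.coe_coe, TensorProduct.lid_tmul, LinearMap.id_apply, smul_smul] at key
    rw [pairingAction_repr p (ℛ k u), pairingAction_repr p (ℛ k u), map_sum, LinearMap.sum_apply]
    simp only [map_smul, LinearMap.smul_apply, pairingAction_repr p (ℛ k ((ℛ k u).right _)),
      hp.mul_right_apply (ℛ k ((ℛ k u).left _)), Finset.sum_smul, Finset.smul_sum, smul_smul]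
    exact key
  mul_act a b h := by
    rw [pairingAction_repr p ((ℛ k a).mul (ℛ k b)), ← (ℛ k h).eq]
    simp only [map_sum, TensorProduct.lift.tmul, LinearMap.compl₁₂_apply, LinearMap.mul_apply_apply]
    simp only [pairingAction_repr p (ℛ k a), pairingAction_repr p (ℛ k b), Finset.sum_mul_sum,
      hp.mul_left_apply _ _ (ℛ k h), Finset.sum_smul, smul_mul_smul_comm, Repr.mul_index,
      Repr.mul_left, Repr.mul_right]
    rw [Finset.sum_comm]
    simp only [Finset.sum_product]
  one_act h := by
    rw [pairingAction_repr p Repr.one]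
    simp [hp.one_left, Algebra.algebraMap_eq_smul_one]

/-- Any Hopf action gives a smash product algebra. Associativity on pure tensors is coassociativity
at the left factor of the third one. -/
theorem IsRightHopfAction.isSmashProductAlgebra {act : A →ₗ[k] H →ₗ[k] A}
    (hact : IsRightHopfAction act) : IsSmashProductAlgebra act where
  mul_assoc x y z := by
    induction x with
    | zero => simp
    | add x₁ x₂ h₁ h₂ => simp only [map_add, LinearMap.add_apply, h₁, h₂]
    | tmul h a =>
    induction y with
    | zero => simp
    | add x₁ x₂ h₁ h₂ => simp only [map_add, LinearMap.add_apply, h₁, h₂]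
    | tmul f b =>
    induction z with
    | zero => simp
    | add x₁ x₂ h₁ h₂ => simp only [map_add, h₁, h₂]
    | tmul g c =>
      simp only [smashMul_repr act _ _ _ (ℛ k f), smashMul_repr act _ _ _ (ℛ k g), map_sum,
        LinearMap.sum_apply, smashMul_repr act _ _ _ ((ℛ k f).mul (ℛ k ((ℛ k g).left _))),
        hact.mul_act_repr _ _ (ℛ k ((ℛ k g).right _)), Repr.mul_index, Repr.mul_left,
        Repr.mul_right, Finset.sum_product, Finset.sum_mul,
        TensorProduct.tmul_sum, hact.act_mul]
      refine Eq.trans ?_ Finset.sum_comm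
      refine Finset.sum_congr rfl fun i _ => ?_
      have key := sum_coassoc (TensorProduct.map (LinearMap.mulLeft k (h * (ℛ k f).left i))
        (LinearMap.mul' k A ∘ₗ TensorProduct.map (act a ∘ₗ LinearMap.mulLeft k ((ℛ k f).right i))
          (LinearMap.mulRight k c ∘ₗ act b))) (ℛ k g) (fun i => ℛ k _) (fun i => ℛ k _)
      simp only [TensorProduct.map_tmul, LinearMap.comp_apply, LinearMap.mul'_apply,
        LinearMap.mulLeft_apply, LinearMap.mulRight_apply, hact.act_mul] at key
      simp only [mul_assoc] at key ⊢
      exact key.symm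
  one_mul x := by
    induction x with
    | zero => simp
    | add x₁ x₂ h₁ h₂ => simp only [map_add, h₁, h₂]
    | tmul f b =>
      rw [smashMul_repr act _ _ _ (ℛ k f)]
      simp only [one_mul, hact.one_act, ← Algebra.smul_def, ← TensorProduct.smul_tmul]
      rw [← TensorProduct.sum_tmul]
      congr 1
      have := congrArg (TensorProduct.rid k H) (sum_tmul_counit_eq (ℛ k f))
      simpa only [map_sum, TensorProduct.rid_tmul, one_smul] using this
  mul_one x := by
    induction x with
    | zero => simp
    | add x₁ x₂ h₁ h₂ => simp only [map_add, LinearMap.add_apply, h₁, h₂]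
    | tmul f b =>
      rw [smashMul_repr act _ _ _ Repr.one]
      simp [hact.act_one]

end HopfPairing

/-! ### Tangent vectors of the automorphism group at the identity -/

namespace OAut

open Coalgebra

variable {k L : Type*} [Field k] [AddCommGroup L] [Module k L] {n : ℕ}
  {μ : L →ₗ[k] L →ₗ[k] L} {b : Module.Basis (Fin n) k L}

@[simp] lemma comul_G (i j : Fin n) :
    comul (R := k) (G μ b i j) = ∑ l, G μ b i l ⊗ₜ[k] G μ b l j := comulHom_G μ b i j

@[simp] lemma comul_Gbar (i j : Fin n) :
    comul (R := k) (Gbar μ b i j) = ∑ l, Gbar μ b l j ⊗ₜ[k] Gbar μ b i l := comulHom_Gbar μ b i j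

@[simp] lemma counit_G (i j : Fin n) :
    counit (R := k) (G μ b i j) = if i = j then 1 else 0 := counitHom_G μ b i j

@[simp] lemma counit_Gbar (i j : Fin n) :
    counit (R := k) (Gbar μ b i j) = if i = j then 1 else 0 := counitHom_Gbar μ b i j

lemma sum_G_mul_Gbar (i j : Fin n) :
    ∑ l, G μ b i l * Gbar μ b l j = if i = j then 1 else 0 := by
  rw [← Matrix.mul_apply, G_mul_Gbar, Matrix.one_apply]

/-- The generators `G^i_j` and `Ḡ^i_j` generate `O(Aut(L))` as an algebra. -/
lemma mem_of_generators_mem (S : Subalgebra k (OAut μ b)) (hG : ∀ i j, G μ b i j ∈ S)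
    (hGbar : ∀ i j, Gbar μ b i j ∈ S) (f : OAut μ b) : f ∈ S := by
  obtain ⟨x, rfl⟩ : ∃ x, mkHom μ b x = f := Ideal.Quotient.mk_surjective f
  induction x using MvPolynomial.induction_on with
  | C c =>
    rw [show mkHom μ b (MvPolynomial.C c) = algebraMap k _ c from (mkHom μ b).commutes c]
    exact S.algebraMap_mem c
  | add p q hp hq => rw [map_add]; exact S.add_mem hp hq
  | mul_X p i hp =>
    rw [map_mul]
    rcases i with ⟨i, j⟩ | ⟨i, j⟩
    exacts [S.mul_mem hp (hG i j), S.mul_mem hp (hGbar i j)]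

/-- A derivation of `O(Aut(L))` at the identity automorphism, that is, a tangent vector there. -/
def IsPointDerivation (d : OAut μ b →ₗ[k] k) : Prop :=
  ∀ f g, d (f * g) = counit f * d g + d f * counit g

namespace IsPointDerivation

variable {d e : OAut μ b →ₗ[k] k}

lemma map_one (hd : IsPointDerivation d) : d 1 = 0 := by
  simpa using hd 1 1

lemma map_mul (hd : IsPointDerivation d) (f g : OAut μ b) :
    d (f * g) = counit f * d g + d f * counit g := hd f g

/-- Differentiating `G Ḡ = 1` at the identity. -/
lemma map_Gbar (hd : IsPointDerivation d) (i j : Fin n) :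
    d (Gbar μ b i j) = -d (G μ b i j) := by
  have h := congrArg d (sum_G_mul_Gbar (μ := μ) (b := b) i j)
  have h0 : d (if i = j then 1 else 0) = 0 := by split_ifs <;> simp [hd.map_one]
  rw [h0, map_sum] at h
  simp only [hd.map_mul, counit_G, counit_Gbar, Finset.sum_add_distrib, ite_mul, one_mul, zero_mul,
    Finset.sum_ite_eq, Finset.mem_univ, if_true, mul_ite, mul_one, mul_zero,
    Finset.sum_ite_eq'] at h
  exact eq_neg_of_add_eq_zero_left h

/-- A tangent vector at the identity is determined by its values on the `G^i_j`. -/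
lemma ext (hd : IsPointDerivation d) (he : IsPointDerivation e)
    (h : ∀ i j, d (G μ b i j) = e (G μ b i j)) : d = e := by
  ext f
  refine mem_of_generators_mem
    { carrier := {f | d f = e f}
      mul_mem' := fun {f g} (hf : d f = e f) (hg : d g = e g) =>
        show d (f * g) = e (f * g) by rw [hd f g, he f g, hf, hg]
      add_mem' := fun {f g} (hf : d f = e f) (hg : d g = e g) =>
        show d (f + g) = e (f + g) by rw [map_add, map_add, hf, hg]
      algebraMap_mem' := fun c =>
        show d (algebraMap k _ c) = e (algebraMap k _ c) by
          simp [Algebra.algebraMap_eq_smul_one, hd.map_one, he.map_one] } h (fun i j => ?_) f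
  exact (hd.map_Gbar i j).trans ((congrArg Neg.neg (h i j)).trans (he.map_Gbar i j).symm)

lemma add (hd : IsPointDerivation d) (he : IsPointDerivation e) : IsPointDerivation (d + e) :=
  fun f g => by simp [hd f g, he f g]; ring

lemma smul (c : k) (hd : IsPointDerivation d) : IsPointDerivation (c • d) :=
  fun f g => by simp [hd f g]; ring

end IsPointDerivation

/-- The coordinates of `F x` in terms of those of `x`. -/
lemma repr_map_apply {M : Type*} [AddCommGroup M] [Module k M] {m : ℕ}
    (b : Module.Basis (Fin n) k L) (c : Module.Basis (Fin m) k M) (F : L →ₗ[k] M) (x : L)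
    (r : Fin m) : c.repr (F x) r = ∑ l, c.repr (F (b l)) r * b.repr x l := by
  rw [← LinearMap.toMatrix_mulVec_repr b c F x]
  simp [Matrix.mulVec, dotProduct, LinearMap.toMatrix_apply]

open TrivSqZeroExt in
/-- When `D` is a derivation of `μ` with matrix `N`, the matrix `1 + ε N` over the dual numbers
respects the product. -/
lemma respectsProduct_one_add_derivation (D : L →ₗ[k] L)
    (hD : ∀ x y, D (μ x y) = μ (D x) y + μ x (D y)) :
    RespectsProduct (R := DualNumber k) (structConst μ b)
      (1 + (LinearMap.toMatrix b b D).map inr) := by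
  intro r i j
  have key := congrArg (fun x => b.repr x r) (hD (b i) (b j))
  simp only [map_add, Finsupp.add_apply] at key
  rw [repr_map_apply b b D, show μ (D (b i)) (b j) = μ.flip (b j) (D (b i)) from rfl,
    repr_map_apply b b (μ.flip (b j)), repr_map_apply b b (μ (b i))] at key
  have hM : ∀ l i, (1 + (LinearMap.toMatrix b b D).map inr :
      Matrix (Fin n) (Fin n) (DualNumber k)) l i =
      inl (if l = i then 1 else 0) + inr (b.repr (D (b i)) l) := by
    intro l i
    rw [Matrix.add_apply, Matrix.one_apply, Matrix.map_apply, LinearMap.toMatrix_apply]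
    split_ifs <;> simp
  simp only [hM, TrivSqZeroExt.algebraMap_eq_inl]
  have hterm : ∀ l m, inl (structConst μ b r l m) *
      (inl (if l = i then 1 else 0) + inr (b.repr (D (b i)) l)) *
      (inl (if m = j then 1 else 0) + inr (b.repr (D (b j)) m)) =
      (inl (structConst μ b r l m * (if l = i then 1 else 0) * (if m = j then 1 else 0)) +
        inr (structConst μ b r l m * b.repr (D (b i)) l * (if m = j then 1 else 0) +
          structConst μ b r l m * (if l = i then 1 else 0) * b.repr (D (b j)) m) :
        DualNumber k) := by
    intro l m
    ext <;> simp
    ring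
  have hterm' : ∀ l, (inl (if r = l then 1 else 0) + inr (b.repr (D (b l)) r)) *
      inl (structConst μ b l i j) =
      (inl ((if r = l then 1 else 0) * structConst μ b l i j) +
        inr (b.repr (D (b l)) r * structConst μ b l i j) : DualNumber k) := by
    intro l
    ext <;> simp [mul_comm]
  simp only [hterm, hterm', Finset.sum_add_distrib, ← inl_sum, ← inr_sum]
  congr 2
  · simp
  · refine Eq.trans ?_ key.symm
    simp [structConst]

open TrivSqZeroExt in
lemma map_inr_mul_map_inr (M N : Matrix (Fin n) (Fin n) k) :
    (M.map inr * N.map inr : Matrix (Fin n) (Fin n) (DualNumber k)) = 0 := by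
  ext1 i j
  simp [Matrix.mul_apply]

open TrivSqZeroExt in
/-- The automorphism `1 + ε D` over the dual numbers, as an algebra map out of `O(Aut(L))`. -/
def dualNumberPoint (D : L →ₗ[k] L) (hD : ∀ x y, D (μ x y) = μ (D x) y + μ x (D y)) :
    OAut μ b →ₐ[k] DualNumber k :=
  lift (1 + (LinearMap.toMatrix b b D).map inr) (1 - (LinearMap.toMatrix b b D).map inr)
    (by rw [mul_sub, mul_one, add_mul, one_mul, map_inr_mul_map_inr]; abel)
    (by rw [mul_add, mul_one, sub_mul, one_mul, map_inr_mul_map_inr]; abel)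
    (respectsProduct_one_add_derivation D hD)

/-- A derivation of the algebra `(L, μ)` as a tangent vector of its automorphism group. -/
def tangent (D : L →ₗ[k] L) (hD : ∀ x y, D (μ x y) = μ (D x) y + μ x (D y)) :
    OAut μ b →ₗ[k] k :=
  TrivSqZeroExt.sndHom k k ∘ₗ (dualNumberPoint D hD).toLinearMap

@[simp]
lemma tangent_G (D : L →ₗ[k] L) (hD : ∀ x y, D (μ x y) = μ (D x) y + μ x (D y)) (i j : Fin n) :
    tangent (b := b) D hD (G μ b i j) = b.repr (D (b j)) i := by
  simp only [tangent, dualNumberPoint, LinearMap.comp_apply, AlgHom.toLinearMap_apply, lift_G]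
  rw [Matrix.add_apply, Matrix.one_apply, Matrix.map_apply, LinearMap.toMatrix_apply]
  split_ifs <;> simp

/-- The automorphism `1 + ε D` specializes to the identity at `ε = 0`. -/
lemma fst_dualNumberPoint (D : L →ₗ[k] L) (hD : ∀ x y, D (μ x y) = μ (D x) y + μ x (D y))
    (f : OAut μ b) : (dualNumberPoint D hD f).fst = counit (R := k) f := by
  refine DFunLike.congr_fun (show (TrivSqZeroExt.fstHom k k k).comp (dualNumberPoint D hD) =
      Bialgebra.counitAlgHom k (OAut μ b) from hom_ext (fun i j => ?_) fun i j => ?_) f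
  · simp only [dualNumberPoint, AlgHom.comp_apply, lift_G, Bialgebra.counitAlgHom_apply, counit_G]
    rw [Matrix.add_apply, Matrix.one_apply, Matrix.map_apply]
    split_ifs <;> simp
  · simp only [dualNumberPoint, AlgHom.comp_apply, lift_Gbar, Bialgebra.counitAlgHom_apply,
      counit_Gbar]
    rw [Matrix.sub_apply, Matrix.one_apply, Matrix.map_apply]
    split_ifs <;> simp

lemma isPointDerivation_tangent (D : L →ₗ[k] L) (hD : ∀ x y, D (μ x y) = μ (D x) y + μ x (D y)) :
    IsPointDerivation (tangent (b := b) D hD) := by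
  intro f g
  have h := fst_dualNumberPoint (b := b) D hD
  simp only [tangent, LinearMap.comp_apply, AlgHom.toLinearMap_apply, map_mul,
    TrivSqZeroExt.sndHom_apply, TrivSqZeroExt.snd_mul, h, smul_eq_mul, MulOpposite.smul_eq_mul_unop,
    MulOpposite.unop_op]

end OAut

/-! ### The canonical pairing -/

namespace UniversalEnvelopingAlgebra

open Coalgebra TensorProduct

variable {k L H : Type*} [Field k] [LieRing L] [LieAlgebra k L] [Ring H] [HopfAlgebra k H]

/-- The Sweedler representation of the primitive element `x ∈ L`. -/
@[simps]
def reprι (x : L) : Repr k (ι k x) Bool where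
  index := Finset.univ
  left i := if i then ι k x else 1
  right i := if i then 1 else ι k x
  eq := by
    rw [Fintype.sum_bool]
    exact (comulHom_ι k L x).symm

lemma counit_ι (x : L) : counit (R := k) (ι k x) = 0 := counitHom_ι k L x

/-- To get a Hopf pairing of `U(L)` with `H`, it suffices to have a multiplicative map to the
convolution algebra of `H` which sends `L` to derivations at the counit. -/
theorem isHopfPairing_of_derivation
    (p : UniversalEnvelopingAlgebra k L →ₗ[k] H →ₗ[k] k)
    (hmul : ∀ (b c : UniversalEnvelopingAlgebra k L) (h : H),
      p (b * c) h = ∑ i ∈ (ℛ k h).index, p b ((ℛ k h).left i) * p c ((ℛ k h).right i))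
    (hone : ∀ h : H, p 1 h = counit h)
    (hder : ∀ x f g, p (ι k x) (f * g) = counit f * p (ι k x) g + p (ι k x) f * counit g) :
    IsHopfPairing p := by
  have hmul' : ∀ (b c : UniversalEnvelopingAlgebra k L) (h : H),
      p (b * c) h = dualDistrib k H H (p b ⊗ₜ p c) (comul h) := by
    intro b c h
    rw [hmul, dualDistrib_comul _ _ (ℛ k h)]
  refine ⟨fun b => ?_, fun b => ?_, hmul', hone⟩
  · refine mem_of_ι_mem
      { carrier := {b | ∀ g h : H,
          p b (g * h) = dualDistrib k H H (TensorProduct.map p p (comul b)) (g ⊗ₜ h)}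
        mul_mem' := fun {b c} hb hc => ?_
        add_mem' := fun {b c} hb hc g h => ?_
        algebraMap_mem' := fun r g h => ?_ } (fun x g h => ?_) b
    · intro g h
      rw [hmul' _ _ _, dualDistrib_comul _ _ ((ℛ k g).mul (ℛ k h)), dualDistrib_map_comul p ((ℛ k b).mul (ℛ k c))]
      simp only [Repr.mul_index, Repr.mul_left, Repr.mul_right, Finset.sum_product,
        hb _ _, hc _ _, dualDistrib_map_comul p (ℛ k b), dualDistrib_map_comul p (ℛ k c), hmul]
      simp only [Finset.sum_mul_sum]
      rw [Finset.sum_congr rfl fun _ _ => Finset.sum_comm, Finset.sum_comm]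
      refine Finset.sum_congr rfl fun _ _ => ?_
      rw [Finset.sum_congr rfl fun _ _ => Finset.sum_comm, Finset.sum_comm]
      refine Finset.sum_congr rfl fun _ _ => Finset.sum_congr rfl fun _ _ =>
        Finset.sum_congr rfl fun _ _ => ?_
      ring
    · simp only [map_add, LinearMap.add_apply, hb g h, hc g h]
    · rw [Algebra.algebraMap_eq_smul_one, map_smul, map_smul, map_smul, map_smul,
        LinearMap.smul_apply, LinearMap.smul_apply, dualDistrib_map_comul p Repr.one]
      simp [hone]
    · rw [dualDistrib_map_comul p (reprι x)]
      simp [hone, hder, -ι_apply, add_comm]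
  · refine mem_of_ι_mem
      { carrier := {b | p b 1 = counit b}
        mul_mem' := fun {b c} (hb : p b 1 = _) (hc : p c 1 = _) => ?_
        add_mem' := fun {b c} (hb : p b 1 = _) (hc : p c 1 = _) => ?_
        algebraMap_mem' := fun r => ?_ } (fun x => ?_) b
    · show p (b * c) 1 = _
      rw [hmul', dualDistrib_comul _ _ Repr.one]
      simp [hb, hc]
    · show p (b + c) 1 = _
      simp [hb, hc]
    · show p (algebraMap k _ r) 1 = _
      simp [Algebra.algebraMap_eq_smul_one, hone]
    · show p (ι k x) 1 = _
      rw [counit_ι]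
      simpa using hder x 1 1

end UniversalEnvelopingAlgebra

namespace OAut

open Coalgebra

variable {k L : Type*} [Field k] [AddCommGroup L] [Module k L] {n : ℕ}
  {μ : L →ₗ[k] L →ₗ[k] L} {b : Module.Basis (Fin n) k L}

/-- The convolution product of two tangent vectors is a differential operator of order two: besides
the Leibniz terms there is a term `e(f) d(g) + d(f) e(g)`, symmetric in `d` and `e`. -/
lemma convMul_mul_of_isPointDerivation {d e : WithConv (OAut μ b →ₗ[k] k)} (hd : IsPointDerivation d.ofConv)
    (he : IsPointDerivation e.ofConv) (f g : OAut μ b) :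
    (d * e) (f * g) = counit f * (d * e) g + e f * d g + d f * e g + (d * e) f * counit g := by
  have h0 := (ℛ k f).convMul_apply 1 (1 : WithConv (OAut μ b →ₗ[k] k))
  have h1 := fun f => (ℛ k f).convMul_apply 1 e
  have h2 := fun f => (ℛ k f).convMul_apply d 1
  have h3 := fun f => (ℛ k f).convMul_apply d e
  have h4 := (ℛ k g).convMul_apply 1 (1 : WithConv (OAut μ b →ₗ[k] k))
  simp only [one_mul, mul_one, LinearMap.convOne_apply, Algebra.algebraMap_self, RingHom.id_apply]
    at h0 h1 h2 h3 h4
  rw [((ℛ k f).mul (ℛ k g)).convMul_apply]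
  simp only [Repr.mul_index, Repr.mul_left, Repr.mul_right, Finset.sum_product, hd.map_mul,
    he.map_mul]
  have h1f := h1 f
  have h2g := h2 g
  have hf : ∑ i ∈ (ℛ k f).index, ∑ j ∈ (ℛ k g).index,
      (d ((ℛ k f).left i) * counit (R := k) ((ℛ k f).right i)) *
      (counit ((ℛ k g).left j) * e ((ℛ k g).right j)) = d f * e g := by
    rw [← Finset.sum_mul_sum, ← h1, ← h2]
  rw [h0, h1f, h2g, h3, h3, h4, ← hf]
  simp only [Finset.sum_mul_sum, ← Finset.sum_add_distrib]
  refine Finset.sum_congr rfl fun _ _ => Finset.sum_congr rfl fun _ _ => ?_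
  ring

/-- The convolution commutator of two tangent vectors at the identity is again one, because the
symmetric second order terms cancel. -/
lemma isPointDerivation_commutator {d e : WithConv (OAut μ b →ₗ[k] k)}
    (hd : IsPointDerivation d.ofConv) (he : IsPointDerivation e.ofConv) :
    IsPointDerivation (d * e - e * d).ofConv := by
  intro f g
  simp only [WithConv.ofConv_sub, LinearMap.sub_apply, convMul_mul_of_isPointDerivation hd he,
    convMul_mul_of_isPointDerivation he hd]
  ring

end OAut

namespace RightLeibnizAlgebra

open UniversalEnvelopingAlgebra Coalgebra

variable {k 𝔥 : Type*} [Field k] [AddCommGroup 𝔥] [Module k 𝔥] [RightLeibnizAlgebra k 𝔥] {n : ℕ}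
  (b : Module.Basis (Fin n) k 𝔥)

/-- The Leibniz identity says that `-[·, x]` is a derivation. -/
lemma neg_right_mul_derivation (x y z : 𝔥) :
    (-(br (k := k)).flip x) (br (k := k) y z) =
      br (k := k) ((-(br (k := k)).flip x) y) z + br (k := k) y ((-(br (k := k)).flip x) z) := by
  simp only [LinearMap.neg_apply, LinearMap.flip_apply, map_neg, leibniz y z x]
  abel

/-- The tangent vector of the automorphism group given by the derivation `-[·, x]`. -/
def rightTangent : 𝔥 →ₗ[k] OAutL b →ₗ[k] k where
  toFun x := OAut.tangent (-(br (k := k)).flip x) (neg_right_mul_derivation x)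
  map_add' x y := (OAut.isPointDerivation_tangent _ _).ext
    ((OAut.isPointDerivation_tangent _ _).add (OAut.isPointDerivation_tangent _ _))
    fun i j => by simp; ring
  map_smul' c x := (OAut.isPointDerivation_tangent _ _).ext
    ((OAut.isPointDerivation_tangent _ _).smul c)
    fun i j => by simp

lemma rightTangent_G (x : 𝔥) (i j : Fin n) :
    rightTangent b x (OAut.G br b i j) = -b.repr (br (k := k) (b j) x) i := by
  simp [rightTangent]

lemma isPointDerivation_rightTangent (x : 𝔥) : OAut.IsPointDerivation (rightTangent b x) :=
  OAut.isPointDerivation_tangent _ _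

/-- The elements acting by zero from the right form an ideal containing all squares. -/
lemma br_eq_zero_of_mem_squareIdeal {x : 𝔥} (hx : x ∈ squareIdeal k 𝔥) (a : 𝔥) :
    br (k := k) a x = 0 := by
  have h : squareIdeal k 𝔥 ≤ LinearMap.ker (br (k := k) (𝔥 := 𝔥)).flip := by
    refine sInf_le ⟨fun x => ?_, fun a x hx => ?_⟩
    · ext a
      simpa using leibniz (k := k) a x x
    · rw [LinearMap.mem_ker] at hx
      have hx' : ∀ y, br (k := k) y x = 0 := fun y => DFunLike.congr_fun hx y
      constructor
      · rw [LinearMap.mem_ker, hx' a, map_zero]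
      · rw [LinearMap.mem_ker]
        ext y
        simpa [hx'] using (leibniz (k := k) y x a).symm
  exact DFunLike.congr_fun (h hx) a

/-- `rightTangent` factors through `𝔥_Lie`. -/
def lieTangent : LieQuotient k 𝔥 →ₗ[k] WithConv (OAutL b →ₗ[k] k) :=
  (squareIdeal k 𝔥).liftQ ((WithConv.linearEquiv k _).symm.toLinearMap ∘ₗ rightTangent b)
    fun x hx => by
      rw [LinearMap.mem_ker]
      have : rightTangent b x = 0 := (isPointDerivation_rightTangent b x).ext
        (fun f g => by simp) fun i j => by
          rw [rightTangent_G, br_eq_zero_of_mem_squareIdeal hx]; simp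
      simp [this]

lemma lieTangent_mk (x : 𝔥) (f : OAutL b) :
    lieTangent b (LieQuotient.mk k 𝔥 x) f = rightTangent b x f := rfl

lemma LieQuotient.lie_mk (x y : 𝔥) :
    ⁅LieQuotient.mk k 𝔥 x, LieQuotient.mk k 𝔥 y⁆ = LieQuotient.mk k 𝔥 (br (k := k) x y) := rfl

/-- The bracket of `𝔥_Lie` goes to the commutator, again by the Leibniz identity. -/
lemma lieTangent_lie (X Y : LieQuotient k 𝔥) :
    lieTangent b ⁅X, Y⁆ = lieTangent b X * lieTangent b Y - lieTangent b Y * lieTangent b X := by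
  obtain ⟨x, rfl⟩ := LieQuotient.mk_surjective X
  obtain ⟨y, rfl⟩ := LieQuotient.mk_surjective Y
  rw [LieQuotient.lie_mk]
  refine WithConv.ofConv_injective <| (isPointDerivation_rightTangent b _).ext
    (OAut.isPointDerivation_commutator (isPointDerivation_rightTangent b x)
      (isPointDerivation_rightTangent b y)) fun i j => ?_
  rw [rightTangent_G]
  simp only [WithConv.ofConv_sub, LinearMap.sub_apply, LinearMap.convMul_apply, OAut.comul_G,
    map_sum, TensorProduct.map_tmul, LinearMap.mul'_apply, lieTangent_mk, rightTangent_G]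
  have hx : ∀ x y : 𝔥, b.repr (br (k := k) (br (k := k) (b j) y) x) i =
      ∑ l, -b.repr (br (k := k) (b l) x) i * -b.repr (br (k := k) (b j) y) l := by
    intro x y
    simpa using OAut.repr_map_apply b b ((br (k := k)).flip x) (br (k := k) (b j) y) i
  rw [← hx, ← hx, leibniz (b j) x y]
  simp

/-- The pairing of `U(𝔥_Lie)` with `O(Aut(𝔥))`, as an algebra map to the convolution algebra. -/
def pairingHom : UEnv k 𝔥 →ₐ[k] WithConv (OAutL b →ₗ[k] k) :=
  liftLinear (lieTangent b) (lieTangent_lie b)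

/-- The canonical pairing of `U(𝔥_Lie)` with `O(Aut(𝔥))`. -/
def canonicalPairing : UEnv k 𝔥 →ₗ[k] OAutL b →ₗ[k] k :=
  (WithConv.linearEquiv k _).toLinearMap ∘ₗ (pairingHom b).toLinearMap

lemma canonicalPairing_toUEnv (x : 𝔥) :
    canonicalPairing b (toUEnv k 𝔥 x) = rightTangent b x := by
  have : pairingHom b (toUEnv k 𝔥 x) = lieTangent b (LieQuotient.mk k 𝔥 x) := liftLinear_ι _ _ _
  exact congrArg WithConv.ofConv this

theorem isCanonicalPairing_canonicalPairing : IsCanonicalPairing b (canonicalPairing b) where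
  hopf := by
    refine isHopfPairing_of_derivation _ (fun x y h => ?_) (fun h => ?_) fun X f g => ?_
    · have : pairingHom b (x * y) = pairingHom b x * pairingHom b y := map_mul _ _ _
      exact (congrArg (fun t => t.ofConv h) this).trans ((ℛ k h).convMul_apply _ _)
    · have : pairingHom b 1 = 1 := map_one _
      exact congrArg (fun t => t.ofConv h) this
    · obtain ⟨x, rfl⟩ := LieQuotient.mk_surjective X
      have := isPointDerivation_rightTangent b x f g
      rwa [← canonicalPairing_toUEnv] at this
  apply_G i j l := by
    rw [canonicalPairing_toUEnv, rightTangent_G]; rfl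

end RightLeibnizAlgebra

/-! ### Uniqueness of the canonical pairing and its action on generators -/

namespace RightLeibnizAlgebra

open UniversalEnvelopingAlgebra Coalgebra

variable {k 𝔥 : Type*} [Field k] [AddCommGroup 𝔥] [Module k 𝔥] [RightLeibnizAlgebra k 𝔥] {n : ℕ}
  (b : Module.Basis (Fin n) k 𝔥)

variable (k 𝔥) in
/-- The map `y ↦ ỹ` as a linear map `𝔥 → U(𝔥_Lie)`. -/
def toUEnvLin : 𝔥 →ₗ[k] UEnv k 𝔥 := ιLin k (LieQuotient k 𝔥) ∘ₗ LieQuotient.mk k 𝔥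

lemma toUEnvLin_apply (y : 𝔥) : toUEnvLin k 𝔥 y = toUEnv k 𝔥 y := rfl

lemma toUEnv_br (x y : 𝔥) : toUEnv k 𝔥 (br (k := k) x y) =
    toUEnv k 𝔥 x * toUEnv k 𝔥 y - toUEnv k 𝔥 y * toUEnv k 𝔥 x :=
  ι_lie (LieQuotient.mk k 𝔥 x) (LieQuotient.mk k 𝔥 y)

lemma toUEnv_br_basis (i j : Fin n) : toUEnv k 𝔥 (br (k := k) (b i) (b j)) =
    ∑ l, structConst br b l i j • toUEnv k 𝔥 (b l) := by
  conv_lhs => rw [← b.sum_repr (br (k := k) (b i) (b j)), ← toUEnvLin_apply, map_sum]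
  simp only [map_smul]
  rfl

/-- The images of a basis of `𝔥` generate `U(𝔥_Lie)` as an algebra. -/
lemma mem_of_toUEnv_basis_mem (S : Subalgebra k (UEnv k 𝔥)) (hS : ∀ j, toUEnv k 𝔥 (b j) ∈ S)
    (a : UEnv k 𝔥) : a ∈ S := by
  refine mem_of_ι_mem S (fun X => ?_) a
  obtain ⟨x, rfl⟩ := LieQuotient.mk_surjective X
  change toUEnvLin k 𝔥 x ∈ S
  rw [← b.sum_repr x, map_sum]
  refine S.sum_mem fun i _ => ?_
  rw [map_smul]
  exact S.smul_mem (hS i) _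

lemma algHom_ext_toUEnv_basis {A : Type*} [Ring A] [Algebra k A] {f g : UEnv k 𝔥 →ₐ[k] A}
    (h : ∀ j, f (toUEnv k 𝔥 (b j)) = g (toUEnv k 𝔥 (b j))) : f = g :=
  AlgHom.ext (mem_of_toUEnv_basis_mem b (AlgHom.equalizer f g) h)

variable {b} {p : UEnv k 𝔥 →ₗ[k] OAutL b →ₗ[k] k}

/-- The primitive elements `ỹ` pair with `O(Aut(𝔥))` by tangent vectors at the identity. -/
lemma isPointDerivation_pairing (hp : IsHopfPairing p) (x : 𝔥) :
    OAut.IsPointDerivation (p (toUEnv k 𝔥 x)) := by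
  intro f g
  rw [toUEnv, hp.mul_right_apply (reprι (k := k) (LieQuotient.mk k 𝔥 x))]
  simp [hp.one_left, -ι_apply, add_comm]

lemma IsCanonicalPairing.apply_toUEnv (hp : IsCanonicalPairing b p) (l : Fin n) :
    p (toUEnv k 𝔥 (b l)) = rightTangent b (b l) :=
  (isPointDerivation_pairing hp.hopf _).ext (isPointDerivation_rightTangent b _) fun i j => by
    rw [hp.apply_G, rightTangent_G]
    rfl

theorem IsCanonicalPairing.eq_canonicalPairing (hp : IsCanonicalPairing b p) :
    p = canonicalPairing b := by
  have hc := isCanonicalPairing_canonicalPairing b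
  ext a : 1
  refine mem_of_toUEnv_basis_mem b
    { carrier := {a | p a = canonicalPairing b a}
      mul_mem' := fun {x y} (hx : _ = _) (hy : _ = _) => ?_
      add_mem' := fun {x y} (hx : _ = _) (hy : _ = _) => ?_
      algebraMap_mem' := fun r => ?_ } (fun j => ?_) a
  · show p (x * y) = canonicalPairing b (x * y)
    ext f
    rw [hp.hopf.mul_left, hc.hopf.mul_left, hx, hy]
  · show p (x + y) = canonicalPairing b (x + y)
    rw [map_add, map_add, hx, hy]
  · show p (algebraMap k _ r) = canonicalPairing b (algebraMap k _ r)
    ext f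
    simp [Algebra.algebraMap_eq_smul_one, hp.hopf.one_left, hc.hopf.one_left]
  · exact (hp.apply_toUEnv j).trans (hc.apply_toUEnv j).symm

lemma IsCanonicalPairing.apply_toUEnv_G (hp : IsCanonicalPairing b p) (x : 𝔥) (i j : Fin n) :
    p (toUEnv k 𝔥 x) (OAut.G br b i j) = -b.repr (br (k := k) (b j) x) i := by
  rw [hp.eq_canonicalPairing, canonicalPairing_toUEnv, rightTangent_G]

lemma IsCanonicalPairing.apply_Gbar (hp : IsCanonicalPairing b p) (i j l : Fin n) :
    p (toUEnv k 𝔥 (b l)) (OAut.Gbar br b i j) = structConst br b i j l := by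
  rw [(isPointDerivation_pairing hp.hopf _).map_Gbar, hp.apply_G, neg_neg]

/-- The action on a primitive element. -/
lemma pairingAction_toUEnv (hp : IsHopfPairing p) (x : 𝔥) (f : OAutL b) :
    pairingAction p (toUEnv k 𝔥 x) f =
      p (toUEnv k 𝔥 x) f • (1 : UEnv k 𝔥) + counit (R := k) f • toUEnv k 𝔥 x := by
  rw [toUEnv, pairingAction_repr p (reprι (k := k) (LieQuotient.mk k 𝔥 x))]
  simp [hp.one_left, -ι_apply]

lemma IsCanonicalPairing.action_Gbar (hp : IsCanonicalPairing b p) (i j l : Fin n) :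
    pairingAction p (toUEnv k 𝔥 (b l)) (OAut.Gbar br b i j) =
      structConst br b i j l • (1 : UEnv k 𝔥) + if i = j then toUEnv k 𝔥 (b l) else 0 := by
  rw [pairingAction_toUEnv hp.hopf, hp.apply_Gbar, OAut.counit_Gbar]
  split_ifs <;> simp

/-! ### The canonical coaction -/

variable (b) in
/-- The linear map `𝔥 → O(Aut(𝔥)) ⊗ U(𝔥_Lie)`, `y_j ↦ ∑_i Ḡ^i_j ⊗ ỹ_i`: the inverse of the generic
automorphism, followed by `y ↦ ỹ`. -/
def genericInverse : 𝔥 →ₗ[k] OAutL b ⊗[k] UEnv k 𝔥 :=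
  b.constr k fun j => ∑ i, OAut.Gbar br b i j ⊗ₜ toUEnv k 𝔥 (b i)

lemma genericInverse_basis (j : Fin n) :
    genericInverse b (b j) = ∑ i, OAut.Gbar br b i j ⊗ₜ toUEnv k 𝔥 (b i) :=
  b.constr_basis k _ j

lemma respects_Gbar : RespectsProduct (structConst (br (k := k)) b) (OAut.Gbar br b) :=
  OAut.respects_inv (OAut.G_mul_Gbar br b) (OAut.Gbar_mul_G br b) (OAut.respects_G br b)

/-- `genericInverse` takes brackets to commutators because `Ḡ` respects the bracket of `𝔥` and
`O(Aut(𝔥))` is commutative. -/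
lemma genericInverse_br (x y : 𝔥) : genericInverse b (br (k := k) x y) =
    genericInverse b x * genericInverse b y - genericInverse b y * genericInverse b x := by
  have key : (br (k := k)).compr₂ (genericInverse b) =
      (LinearMap.mul k _).compl₁₂ (genericInverse b) (genericInverse b) -
        ((LinearMap.mul k _).compl₁₂ (genericInverse b) (genericInverse b)).flip := by
    refine LinearMap.ext_basis b b fun i j => ?_
    simp only [LinearMap.compr₂_apply, LinearMap.sub_apply, LinearMap.flip_apply,
      LinearMap.compl₁₂_apply, LinearMap.mul_apply_apply]
    -- Both sides are combinations of the `ỹ_r`; their coefficients agree since `Ḡ` respects the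
    -- bracket.
    have hl : genericInverse b (br (k := k) (b i) (b j)) =
        ∑ r, (∑ l, OAut.Gbar br b r l * algebraMap k _ (structConst br b l i j)) ⊗ₜ[k]
          toUEnv k 𝔥 (b r) := by
      conv_lhs => rw [← b.sum_repr (br (k := k) (b i) (b j)), map_sum]
      simp only [map_smul, genericInverse_basis, TensorProduct.sum_tmul, Finset.smul_sum]
      rw [Finset.sum_comm]
      refine Finset.sum_congr rfl fun r _ => Finset.sum_congr rfl fun l _ => ?_
      rw [TensorProduct.smul_tmul', ← Algebra.commutes, ← Algebra.smul_def]
      rfl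
    have hterm : ∀ l m, (OAut.Gbar br b l i * OAut.Gbar br b m j) ⊗ₜ[k]
        (toUEnv k 𝔥 (b l) * toUEnv k 𝔥 (b m) - toUEnv k 𝔥 (b m) * toUEnv k 𝔥 (b l)) =
        ∑ r, (algebraMap k _ (structConst br b r l m) * OAut.Gbar br b l i * OAut.Gbar br b m j)
          ⊗ₜ[k] toUEnv k 𝔥 (b r) := by
      intro l m
      rw [← toUEnv_br, toUEnv_br_basis, TensorProduct.tmul_sum]
      refine Finset.sum_congr rfl fun r _ => ?_
      rw [mul_assoc, ← Algebra.smul_def, TensorProduct.smul_tmul]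
    have hr : genericInverse b (b i) * genericInverse b (b j) -
        genericInverse b (b j) * genericInverse b (b i) = ∑ l, ∑ m,
        (OAut.Gbar br b l i * OAut.Gbar br b m j) ⊗ₜ[k]
          (toUEnv k 𝔥 (b l) * toUEnv k 𝔥 (b m) - toUEnv k 𝔥 (b m) * toUEnv k 𝔥 (b l)) := by
      rw [genericInverse_basis, genericInverse_basis, Finset.sum_mul_sum, Finset.sum_mul_sum,
        Finset.sum_comm (f := fun m l => OAut.Gbar br b m j ⊗ₜ[k] toUEnv k 𝔥 (b m) *
          OAut.Gbar br b l i ⊗ₜ[k] toUEnv k 𝔥 (b l)), ← Finset.sum_sub_distrib]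
      refine Finset.sum_congr rfl fun l _ => ?_
      rw [← Finset.sum_sub_distrib]
      refine Finset.sum_congr rfl fun m _ => ?_
      rw [Algebra.TensorProduct.tmul_mul_tmul, Algebra.TensorProduct.tmul_mul_tmul,
        TensorProduct.tmul_sub, mul_comm (OAut.Gbar br b m j)]
    rw [hl, hr]
    simp only [hterm, ← respects_Gbar _ i j, TensorProduct.sum_tmul]
    rw [Finset.sum_comm]
    exact Finset.sum_congr rfl fun _ _ => Finset.sum_comm
  simpa using LinearMap.congr_fun₂ key x y

/-- The kernel of `genericInverse` is an ideal containing all squares, as it is the kernel of a map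
into commutators. -/
lemma genericInverse_eq_zero {x : 𝔥} (hx : x ∈ squareIdeal k 𝔥) : genericInverse b x = 0 := by
  have h : squareIdeal k 𝔥 ≤ LinearMap.ker (genericInverse b) := by
    refine sInf_le ⟨fun x => ?_, fun a x hx => ?_⟩
    · rw [LinearMap.mem_ker, genericInverse_br, sub_self]
    · rw [LinearMap.mem_ker] at hx
      simp [LinearMap.mem_ker, genericInverse_br, hx]
  exact h hx

variable (b) in
/-- The canonical coaction, as an algebra map to the ordinary tensor product of algebras; its
antimultiplicativity refers to the smash product instead. -/
def coactionHom : UEnv k 𝔥 →ₐ[k] OAutL b ⊗[k] UEnv k 𝔥 :=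
  liftLinear ((squareIdeal k 𝔥).liftQ (genericInverse b) fun _ hx => genericInverse_eq_zero hx :
      LieQuotient k 𝔥 →ₗ[k] OAutL b ⊗[k] UEnv k 𝔥) fun X Y => by
    obtain ⟨x, rfl⟩ := LieQuotient.mk_surjective X
    obtain ⟨y, rfl⟩ := LieQuotient.mk_surjective Y
    exact genericInverse_br x y

lemma coactionHom_toUEnv (x : 𝔥) : coactionHom b (toUEnv k 𝔥 x) = genericInverse b x :=
  liftLinear_ι _ _ _

lemma coactionHom_toUEnv_basis (j : Fin n) : coactionHom b (toUEnv k 𝔥 (b j)) =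
    ∑ i, OAut.Gbar br b i j ⊗ₜ toUEnv k 𝔥 (b i) := by
  rw [coactionHom_toUEnv, genericInverse_basis]

theorem isLeftCoaction_coactionHom : IsLeftCoaction (coactionHom b).toLinearMap where
  coassoc a := by
    refine DFunLike.congr_fun (show ((Algebra.TensorProduct.assoc k k k _ _ _).toAlgHom.comp
      (Algebra.TensorProduct.map (Bialgebra.comulAlgHom k (OAutL b)) (.id k _))).comp
        (coactionHom b) = (Algebra.TensorProduct.map (.id k (OAutL b)) (coactionHom b)).comp
        (coactionHom b) from algHom_ext_toUEnv_basis b fun j => ?_) a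
    simp [coactionHom_toUEnv_basis, TensorProduct.sum_tmul, TensorProduct.tmul_sum]
    exact Finset.sum_comm
  counit a := by
    refine DFunLike.congr_fun (show ((Algebra.TensorProduct.lid k _).toAlgHom.comp
      (Algebra.TensorProduct.map (Bialgebra.counitAlgHom k (OAutL b)) (.id k _))).comp
        (coactionHom b) = .id k _ from algHom_ext_toUEnv_basis b fun j => ?_) a
    simp [coactionHom_toUEnv_basis]

end RightLeibnizAlgebra

/-! ### Yetter–Drinfeld conditions on subalgebras -/

section SmashProduct

open TensorProduct Coalgebra

variable {k H A : Type*} [Field k] [CommRing H] [HopfAlgebra k H] [Ring A] [Algebra k A]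

/-- The left-hand side `f₍₂₎ (a ◁ f₍₁₎)₍₋₁₎ ⊗ (a ◁ f₍₁₎)₍₀₎` of the Yetter–Drinfeld condition. -/
def ydLeft (act : A →ₗ[k] H →ₗ[k] A) (lam : A →ₗ[k] H ⊗[k] A) (a : A) (f : H) : H ⊗[k] A :=
  TensorProduct.lift ((LinearMap.rTensorHom A ∘ₗ LinearMap.mul k H).flip ∘ₗ lam ∘ₗ act a) (comul f)

/-- The map `(h ⊗ u, f) ↦ h f₍₁₎ ⊗ (u ◁ f₍₂₎)`, which takes `λ(a)` to the right-hand side of the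
Yetter–Drinfeld condition. -/
def ydRight (act : A →ₗ[k] H →ₗ[k] A) (f : H) : H ⊗[k] A →ₗ[k] H ⊗[k] A :=
  TensorProduct.lift ((TensorProduct.mapBilinear (.id k) H A H A).compl₁₂ (LinearMap.mul k H).flip
          act.flip) (comul f)

lemma ydRight_eq (act : A →ₗ[k] H →ₗ[k] A) (f : H) (X : H ⊗[k] A) :
    TensorProduct.lift
        (((TensorProduct.mapBilinear (.id k) H A H A).compl₁₂ (LinearMap.mul k H).flip
          act.flip).compr₂ (LinearMap.applyₗ X)) (comul f) = ydRight act f X := by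
  rw [ydRight, ← (ℛ k f).eq]
  simp

lemma ydLeft_repr (act : A →ₗ[k] H →ₗ[k] A) (lam : A →ₗ[k] H ⊗[k] A) (a : A) {f : H} {ι : Type*}
    (r : Repr k f ι) :
    ydLeft act lam a f = ∑ i ∈ r.index, lam (act a (r.left i)) * (r.right i ⊗ₜ 1) := by
  have h : ∀ (g : H) (X : H ⊗[k] A), (LinearMap.mul k H g).rTensor A X = X * (g ⊗ₜ 1) := by
    intro g X
    induction X with
    | zero => simp
    | add X Y hX hY => rw [map_add, hX, hY, add_mul]
    | tmul x u => simp [mul_comm]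
  rw [ydLeft, ← r.eq, map_sum]
  exact Finset.sum_congr rfl fun i _ => h _ _

lemma ydRight_tmul_repr (act : A →ₗ[k] H →ₗ[k] A) (h : H) (u : A) {f : H} {ι : Type*}
    (r : Repr k f ι) : ydRight act f (h ⊗ₜ u) =
      ∑ i ∈ r.index, (h * r.left i) ⊗ₜ act u (r.right i) := by
  rw [ydRight, ← r.eq]
  simp [mul_comm h]

variable {act : A →ₗ[k] H →ₗ[k] A} (hact : IsRightHopfAction act)
include hact

lemma ydLeft_mul {lam : A →ₐ[k] H ⊗[k] A} (a a' : A) {f : H} {ι : Type*} (r : Repr k f ι) :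
    ydLeft act lam.toLinearMap (a * a') f = ∑ i ∈ r.index,
      lam (act a (r.left i)) * ydLeft act lam.toLinearMap a' (r.right i) := by
  have key := sum_coassoc (LinearMap.mul' k _ ∘ₗ TensorProduct.map (lam.toLinearMap ∘ₗ act a)
    (LinearMap.mul' k _ ∘ₗ TensorProduct.map (lam.toLinearMap ∘ₗ act a')
      (Algebra.TensorProduct.includeLeft : H →ₐ[k] H ⊗[k] A).toLinearMap))
      r (fun _ => ℛ k _) (fun _ => ℛ k _)
  simp only [LinearMap.comp_apply, TensorProduct.map_tmul, LinearMap.mul'_apply,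
    AlgHom.toLinearMap_apply, Algebra.TensorProduct.includeLeft_apply] at key
  rw [ydLeft_repr _ _ _ r]
  simp only [hact.mul_act_repr _ _ (ℛ k (r.left _)), ydLeft_repr _ _ _ (ℛ k (r.right _)), map_sum,
    map_mul, Finset.sum_mul, Finset.mul_sum, AlgHom.toLinearMap_apply, mul_assoc]
  exact key

omit hact in
lemma sum_mul_ydRight_tmul {lam : A →ₐ[k] H ⊗[k] A} (a : A) (h : H) (u : A) {f : H} {ι : Type*}
    (r : Repr k f ι) : ∑ i ∈ r.index, lam (act a (r.left i)) * ydRight act (r.right i) (h ⊗ₜ u) =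
      ∑ i ∈ r.index, ydLeft act lam.toLinearMap a (r.left i) * (h ⊗ₜ act u (r.right i)) := by
  have key := sum_coassoc (LinearMap.mul' k _ ∘ₗ TensorProduct.map (lam.toLinearMap ∘ₗ act a)
    (TensorProduct.map (LinearMap.mulLeft k h) (act u))) r (fun _ => ℛ k _) (fun _ => ℛ k _)
  simp only [LinearMap.comp_apply, TensorProduct.map_tmul, LinearMap.mul'_apply,
    AlgHom.toLinearMap_apply, LinearMap.mulLeft_apply] at key
  simp only [ydRight_tmul_repr _ _ _ (ℛ k (r.right _)), ydLeft_repr _ _ _ (ℛ k (r.left _)),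
    Finset.sum_mul, Finset.mul_sum, AlgHom.toLinearMap_apply, mul_assoc,
    Algebra.TensorProduct.tmul_mul_tmul, one_mul]
  rw [← key]
  simp only [mul_comm h]

lemma ydRight_mul_tmul (X : H ⊗[k] A) (h : H) (u : A) {f : H} {ι : Type*} (r : Repr k f ι) :
    ydRight act f (X * (h ⊗ₜ u)) =
      ∑ i ∈ r.index, ydRight act (r.left i) X * (h ⊗ₜ act u (r.right i)) := by
  induction X with
  | zero => simp
  | add X Y hX hY => simp only [add_mul, map_add, hX, hY, Finset.sum_add_distrib]
  | tmul g v =>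
    have key := sum_coassoc (TensorProduct.map (LinearMap.mulLeft k (g * h))
      (LinearMap.mul' k A ∘ₗ TensorProduct.map (act v) (act u)))
      r (fun _ => ℛ k _) (fun _ => ℛ k _)
    simp only [LinearMap.comp_apply, TensorProduct.map_tmul, LinearMap.mul'_apply,
      LinearMap.mulLeft_apply] at key
    rw [Algebra.TensorProduct.tmul_mul_tmul, ydRight_tmul_repr _ _ _ r]
    simp only [ydRight_tmul_repr _ _ _ (ℛ k (r.left _)), hact.mul_act_repr _ _ (ℛ k (r.right _)),
      Finset.sum_mul, TensorProduct.tmul_sum, Algebra.TensorProduct.tmul_mul_tmul]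
    rw [← key]
    simp only [mul_right_comm g h]

/-- The elements satisfying the Yetter–Drinfeld condition form a subalgebra, provided `H` is
commutative and `λ` is multiplicative into the ordinary tensor product. -/
def ydSubalgebra (lam : A →ₐ[k] H ⊗[k] A) : Subalgebra k A where
  carrier := {a | ∀ f, ydLeft act lam.toLinearMap a f = ydRight act f (lam a)}
  add_mem' {a a'} ha ha' f := by
    have : ydLeft act lam.toLinearMap (a + a') f =
        ydLeft act lam.toLinearMap a f + ydLeft act lam.toLinearMap a' f := by
      simp only [ydLeft_repr _ _ _ (ℛ k f), map_add, LinearMap.add_apply, add_mul,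
        Finset.sum_add_distrib]
    rw [this, ha, ha', map_add, map_add]
  mul_mem' {a a'} ha ha' f := by
    -- By linearity in `Y`, multiplicativity of the right-hand side at a pure tensor is enough.
    have key : ∀ Y, ∑ i ∈ (ℛ k f).index,
        lam (act a ((ℛ k f).left i)) * ydRight act ((ℛ k f).right i) Y =
          ydRight act f (lam a * Y) := by
      intro Y
      induction Y with
      | zero => simp
      | add X Y hX hY => simp only [mul_add, map_add, Finset.sum_add_distrib, hX, hY]
      | tmul h u =>
        rw [sum_mul_ydRight_tmul, ydRight_mul_tmul hact _ _ _ (ℛ k f)]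
        simp only [ha _]
    rw [ydLeft_mul hact _ _ (ℛ k f), map_mul, ← key]
    simp only [ha' _]
  algebraMap_mem' c f := by
    have h1 := congrArg (TensorProduct.lid k H) (sum_counit_tmul_eq (ℛ k f))
    have h2 := congrArg (TensorProduct.rid k H) (sum_tmul_counit_eq (ℛ k f))
    simp only [map_sum, TensorProduct.lid_tmul, TensorProduct.rid_tmul, one_smul] at h1 h2
    rw [Algebra.algebraMap_eq_smul_one, map_smul, map_smul, map_one,
      Algebra.TensorProduct.one_def, ydLeft_repr _ _ _ (ℛ k f), ydRight_tmul_repr _ _ _ (ℛ k f)]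
    simp only [map_smul, LinearMap.smul_apply, hact.one_act, AlgHom.toLinearMap_apply,
      AlgHom.commutes, ← Algebra.smul_def, smul_mul_assoc, one_mul, TensorProduct.smul_tmul']
    simp only [Algebra.algebraMap_eq_smul_one, ← TensorProduct.smul_tmul, ← TensorProduct.sum_tmul,
      ← Finset.smul_sum]
    rw [h1, h2, TensorProduct.smul_tmul']

/-- The elements `b` with `(a ◁ b₍₋₁₎) b₍₀₎ = b a` for all `a` form a subalgebra. -/
def braidedCommutativeSubalgebra (lam : A →ₐ[k] H ⊗[k] A) : Subalgebra k A where
  carrier := {b | ∀ a, TensorProduct.lift (LinearMap.mul k A ∘ₗ act a) (lam b) = b * a}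
  add_mem' {b b'} hb hb' a := by rw [map_add, map_add, hb, hb', add_mul]
  mul_mem' {b b'} hb hb' a := by
    have key : ∀ Y, TensorProduct.lift (LinearMap.mul k A ∘ₗ act a) (lam b * Y) =
        b * TensorProduct.lift (LinearMap.mul k A ∘ₗ act a) Y := by
      intro Y
      induction Y with
      | zero => simp
      | add X Y hX hY => simp only [mul_add, map_add, hX, hY]
      | tmul g v =>
        have : ∀ X : H ⊗[k] A, TensorProduct.lift (LinearMap.mul k A ∘ₗ act a) (X * (g ⊗ₜ v)) =
            TensorProduct.lift (LinearMap.mul k A ∘ₗ act (act a g)) X * v := by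
          intro X
          induction X with
          | zero => simp
          | add X Y hX hY => simp only [add_mul, map_add, hX, hY]
          | tmul h u => simp [mul_comm h g, hact.act_mul, mul_assoc]
        rw [this, hb]
        simp [mul_assoc]
    rw [map_mul, key, hb', mul_assoc]
  algebraMap_mem' c a := by
    rw [AlgHom.commutes, Algebra.TensorProduct.algebraMap_apply, Algebra.algebraMap_eq_smul_one,
      Algebra.algebraMap_eq_smul_one]
    simp [hact.act_one]

/-- The elements `v` with `λ(v z) = λ(z) λ(v)` in the smash product for all `z` form a
subalgebra, by associativity of the smash product. -/
def antimultiplicativeSubalgebra (lam : A →ₐ[k] H ⊗[k] A) : Subalgebra k A where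
  carrier := {v | ∀ z, smashMul act (lam z) (lam v) = lam (v * z)}
  add_mem' {b b'} hb hb' a := by rw [map_add, map_add, hb, hb', add_mul, map_add]
  mul_mem' {v v'} hv hv' z := by
    rw [mul_assoc, ← hv (v' * z), ← hv' z, hact.isSmashProductAlgebra.mul_assoc, hv]
  algebraMap_mem' c z := by
    have := hact.isSmashProductAlgebra.mul_one (lam z)
    rw [Algebra.algebraMap_eq_smul_one, map_smul, map_smul, map_one, smul_mul_assoc, one_mul,
      map_smul]
    exact congrArg (c • ·) this

omit hact in
/-- As `H` is commutative, the multiplication of `Hᵒᵖ ⊗ A` is that of `H ⊗ A`. -/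
lemma map₂_mul_flip_eq_mul (X Y : H ⊗[k] A) :
    TensorProduct.map₂ (LinearMap.mul k H).flip (LinearMap.mul k A) X Y = X * Y := by
  induction X with
  | zero => simp
  | add X X' hX hX' => simp only [map_add, LinearMap.add_apply, add_mul, hX, hX']
  | tmul h a =>
    induction Y with
    | zero => simp
    | add Y Y' hY hY' => simp only [map_add, mul_add, hY, hY']
    | tmul g c => simp

end SmashProduct

/-! ### Invariant vector fields on the automorphism group -/

namespace OAut

open Coalgebra

variable {k L : Type*} [Field k] [AddCommGroup L] [Module k L] {n : ℕ}
  {μ : L →ₗ[k] L →ₗ[k] L} {b : Module.Basis (Fin n) k L}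

lemma lid_rTensor_comul {d : OAut μ b →ₗ[k] k} {f : OAut μ b} {ι : Type*} (r : Repr k f ι) :
    TensorProduct.lid k _ (d.rTensor _ (comul f)) = ∑ i ∈ r.index, d (r.left i) • r.right i := by
  simp [← r.eq]

lemma rid_lTensor_comul {d : OAut μ b →ₗ[k] k} {f : OAut μ b} {ι : Type*} (r : Repr k f ι) :
    TensorProduct.rid k _ (d.lTensor _ (comul f)) = ∑ i ∈ r.index, d (r.right i) • r.left i := by
  simp [← r.eq]

/-- The bookkeeping common to the Leibniz rules of the two kinds of invariant vector fields. -/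
lemma sum_leibniz {R ι κ : Type*} [CommRing R] [Algebra k R] (s : Finset ι) (t : Finset κ)
    (ε d : ι → k) (x : ι → R) (ε' d' : κ → k) (y : κ → R) :
    ∑ i ∈ s, ∑ j ∈ t, (ε i * d' j + d i * ε' j) • (x i * y j) =
      (∑ i ∈ s, ε i • x i) * (∑ j ∈ t, d' j • y j) +
        (∑ j ∈ t, ε' j • y j) * ∑ i ∈ s, d i • x i := by
  rw [mul_comm (∑ j ∈ t, _), Finset.sum_mul_sum, Finset.sum_mul_sum, ← Finset.sum_add_distrib]
  refine Finset.sum_congr rfl fun i _ => ?_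
  rw [← Finset.sum_add_distrib]
  refine Finset.sum_congr rfl fun j _ => ?_
  simp only [smul_mul_smul_comm, ← add_smul]

/-- The invariant vector field `f ↦ d(f₍₁₎) f₍₂₎` extending the tangent vector `d`. -/
def vectorFieldLeft {d : OAut μ b →ₗ[k] k} (hd : IsPointDerivation d) :
    Derivation k (OAut μ b) (OAut μ b) :=
  Derivation.mk' ((TensorProduct.lid k _).toLinearMap ∘ₗ d.rTensor _ ∘ₗ comul) fun f g => by
    have hε := fun f : OAut μ b => sum_counit_smul (ℛ k f)
    simp only [LinearMap.comp_apply, LinearEquiv.coe_coe]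
    rw [lid_rTensor_comul (ℛ k f), lid_rTensor_comul (ℛ k g),
      lid_rTensor_comul ((ℛ k f).mul (ℛ k g))]
    simp only [Repr.mul_index, Repr.mul_left, Repr.mul_right, Finset.sum_product, hd.map_mul,
      smul_eq_mul]
    rw [sum_leibniz, hε, hε]

/-- The invariant vector field `f ↦ f₍₁₎ d(f₍₂₎)` extending the tangent vector `d`. -/
def vectorFieldRight {d : OAut μ b →ₗ[k] k} (hd : IsPointDerivation d) :
    Derivation k (OAut μ b) (OAut μ b) :=
  Derivation.mk' ((TensorProduct.rid k _).toLinearMap ∘ₗ d.lTensor _ ∘ₗ comul) fun f g => by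
    have hε : ∀ f : OAut μ b, ∑ i ∈ (ℛ k f).index,
        counit (R := k) ((ℛ k f).right i) • (ℛ k f).left i = f := by
      intro f
      have := congrArg (TensorProduct.rid k _) (sum_tmul_counit_eq (ℛ k f))
      simpa only [map_sum, TensorProduct.rid_tmul, one_smul] using this
    simp only [LinearMap.comp_apply, LinearEquiv.coe_coe]
    rw [rid_lTensor_comul (ℛ k f), rid_lTensor_comul (ℛ k g),
      rid_lTensor_comul ((ℛ k f).mul (ℛ k g))]
    simp only [Repr.mul_index, Repr.mul_left, Repr.mul_right, Finset.sum_product, hd.map_mul,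
      smul_eq_mul]
    rw [sum_leibniz, hε, hε]

lemma derivation_ext {D E : Derivation k (OAut μ b) (OAut μ b)}
    (hG : ∀ i j, D (G μ b i j) = E (G μ b i j))
    (hGbar : ∀ i j, D (Gbar μ b i j) = E (Gbar μ b i j)) : D = E := by
  ext f
  exact mem_of_generators_mem
    { carrier := {f | D f = E f}
      mul_mem' := fun {f g} (hf : D f = E f) (hg : D g = E g) =>
        show D (f * g) = E (f * g) by rw [D.leibniz, E.leibniz, hf, hg]
      add_mem' := fun {f g} (hf : D f = E f) (hg : D g = E g) =>
        show D (f + g) = E (f + g) by rw [map_add, map_add, hf, hg]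
      algebraMap_mem' := fun c =>
        show D (algebraMap k _ c) = E (algebraMap k _ c) by
          rw [D.map_algebraMap, E.map_algebraMap] } hG hGbar f

end OAut

/-! ### The Yetter–Drinfeld structure -/

namespace RightLeibnizAlgebra

open UniversalEnvelopingAlgebra Coalgebra

variable {k 𝔥 : Type*} [Field k] [AddCommGroup 𝔥] [Module k 𝔥] [RightLeibnizAlgebra k 𝔥] {n : ℕ}
  {b : Module.Basis (Fin n) k 𝔥} {p : UEnv k 𝔥 →ₗ[k] OAutL b →ₗ[k] k}

namespace IsCanonicalPairing

/-- Braided commutativity with the generators `ỹ_l`. -/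
lemma sum_action_Gbar_mul (hp : IsCanonicalPairing b p) (l : Fin n) (a : UEnv k 𝔥) :
    ∑ c, pairingAction p a (OAut.Gbar br b c l) * toUEnv k 𝔥 (b c) = toUEnv k 𝔥 (b l) * a := by
  have hact := hp.hopf.isRightHopfAction
  refine mem_of_toUEnv_basis_mem b
    { carrier := {a | ∀ l, ∑ c, pairingAction p a (OAut.Gbar br b c l) * toUEnv k 𝔥 (b c) =
        toUEnv k 𝔥 (b l) * a}
      add_mem' := fun {a a'} ha ha' l => ?_
      mul_mem' := fun {a a'} ha ha' l => ?_
      algebraMap_mem' := fun r l => ?_ } (fun j l => ?_) a l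
  · have h : ∀ c, pairingAction p (a * a') (OAut.Gbar br b c l) =
        ∑ m, pairingAction p a (OAut.Gbar br b m l) * pairingAction p a' (OAut.Gbar br b c m) := by
      intro c
      rw [hact.mul_act, OAut.comul_Gbar]
      simp
    change ∑ c, pairingAction p (a * a') (OAut.Gbar br b c l) * toUEnv k 𝔥 (b c) = _
    simp only [h, Finset.sum_mul, mul_assoc]
    rw [Finset.sum_comm]
    simp only [← Finset.mul_sum, ha' _]
    simp only [← mul_assoc, ← Finset.sum_mul, ha l]
  · change ∑ c, pairingAction p (a + a') (OAut.Gbar br b c l) * toUEnv k 𝔥 (b c) = _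
    simp only [map_add, LinearMap.add_apply, add_mul, Finset.sum_add_distrib, mul_add, ha l, ha' l]
  · simp [Algebra.algebraMap_eq_smul_one, hact.one_act]
  · simp only [hp.action_Gbar, add_mul, Finset.sum_add_distrib, smul_mul_assoc, one_mul, ite_mul,
      zero_mul, Finset.sum_ite_eq', Finset.mem_univ, if_true, ← toUEnv_br_basis, toUEnv_br]
    abel

theorem isBraidedCommutative (hp : IsCanonicalPairing b p) :
    IsBraidedCommutative (pairingAction p) (coactionHom b).toLinearMap := fun a x =>
  mem_of_toUEnv_basis_mem b
    (braidedCommutativeSubalgebra hp.hopf.isRightHopfAction (coactionHom b))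
    (fun j a => by
      rw [coactionHom_toUEnv_basis, ← hp.sum_action_Gbar_mul]
      simp) x a

theorem isUnitalAntimultiplicative (hp : IsCanonicalPairing b p) :
    IsUnitalAntimultiplicative (pairingAction p) (coactionHom b).toLinearMap where
  map_one := map_one (coactionHom b)
  map_mul v z := by
    refine (mem_of_toUEnv_basis_mem b
      (antimultiplicativeSubalgebra hp.hopf.isRightHopfAction (coactionHom b))
      (fun j z => ?_) v z).symm
    rw [map_mul]
    generalize coactionHom b z = X
    rw [coactionHom_toUEnv_basis]
    induction X with
    | zero => simp
    | add X Y hX hY => rw [map_add, LinearMap.add_apply, hX, hY, mul_add]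
    | tmul f u =>
      have h : ∀ c, smashMul (pairingAction p) (f ⊗ₜ u)
          (OAut.Gbar br b c j ⊗ₜ toUEnv k 𝔥 (b c)) = ∑ l, (f * OAut.Gbar br b l j) ⊗ₜ[k]
            (pairingAction p u (OAut.Gbar br b c l) * toUEnv k 𝔥 (b c)) := fun c =>
        smashMul_tmul _ _ _ _ _ Finset.univ (fun l => OAut.Gbar br b l j)
          (fun l => OAut.Gbar br b c l) (OAut.comul_Gbar c j)
      simp only [map_sum, h]
      rw [Finset.sum_comm]
      simp only [← TensorProduct.tmul_sum, hp.sum_action_Gbar_mul, Finset.sum_mul,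
        Algebra.TensorProduct.tmul_mul_tmul, mul_comm f]

/-- The vector field `f ↦ ⟨ỹ_j, f₍₁₎⟩ f₍₂₎` is the combination with coefficients `Ḡ^a_j` of the vector
fields `f ↦ f₍₁₎ ⟨ỹ_a, f₍₂₎⟩`. -/
lemma vectorFieldLeft_apply_eq_sum (hp : IsCanonicalPairing b p) (j : Fin n) (f : OAutL b) :
    OAut.vectorFieldLeft (isPointDerivation_pairing hp.hopf (b j)) f =
      ∑ a, OAut.Gbar br b a j *
        OAut.vectorFieldRight (isPointDerivation_pairing hp.hopf (b a)) f := by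
  have hsum : ∀ f, (∑ a, OAut.Gbar br b a j •
      OAut.vectorFieldRight (isPointDerivation_pairing hp.hopf (b a))) f = ∑ a, OAut.Gbar br b a j *
        OAut.vectorFieldRight (isPointDerivation_pairing hp.hopf (b a)) f := by
    intro f
    rw [← Derivation.coeFnAddMonoidHom_apply, map_sum, Finset.sum_apply]
    rfl
  suffices h : OAut.vectorFieldLeft (isPointDerivation_pairing hp.hopf (b j)) =
      ∑ a, OAut.Gbar br b a j • OAut.vectorFieldRight (isPointDerivation_pairing hp.hopf (b a)) by
    rw [h, hsum]
  refine OAut.derivation_ext (fun i m => ?_) fun i m => ?_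
  · have hL : OAut.vectorFieldLeft (isPointDerivation_pairing hp.hopf (b j)) (OAut.G br b i m) =
        ∑ l, p (toUEnv k 𝔥 (b j)) (OAut.G br b i l) • OAut.G br b l m := by
      simp [OAut.vectorFieldLeft]
    have hR : ∀ a, OAut.vectorFieldRight (isPointDerivation_pairing hp.hopf (b a))
        (OAut.G br b i m) =
        -∑ l, OAut.G br b i l * algebraMap k _ (structConst br b l m a) := by
      intro a
      simp [OAut.vectorFieldRight, hp.apply_G, Algebra.smul_def, mul_comm]
    rw [hL, hsum]
    simp only [hR, ← OAut.respects_G br b i m, hp.apply_G, mul_neg, Finset.mul_sum, neg_smul,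
      Finset.sum_neg_distrib]
    rw [Finset.sum_comm]
    congr 1
    refine Finset.sum_congr rfl fun l _ => ?_
    rw [Finset.sum_comm]
    have h : ∀ q a, OAut.Gbar br b a j * (algebraMap k _ (structConst br b i l q) *
        OAut.G br b l m * OAut.G br b q a) = algebraMap k _ (structConst br b i l q) *
        OAut.G br b l m * (OAut.G br b q a * OAut.Gbar br b a j) := fun q a => by ring
    simp only [h, ← Finset.mul_sum, OAut.sum_G_mul_Gbar]
    simp [Algebra.smul_def]
  · have hL : OAut.vectorFieldLeft (isPointDerivation_pairing hp.hopf (b j))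
        (OAut.Gbar br b i m) =
        ∑ l, OAut.Gbar br b i l * algebraMap k _ (structConst br b l m j) := by
      simp [OAut.vectorFieldLeft, hp.apply_Gbar, Algebra.smul_def, mul_comm]
    have hR : ∀ a, OAut.vectorFieldRight (isPointDerivation_pairing hp.hopf (b a))
        (OAut.Gbar br b i m) =
        ∑ l, structConst br b i l a • OAut.Gbar br b l m := by
      intro a
      simp [OAut.vectorFieldRight, hp.apply_Gbar]
    rw [hL, hsum, ← respects_Gbar i m j, Finset.sum_comm]
    simp only [hR, Finset.mul_sum, Algebra.smul_def]
    exact Finset.sum_congr rfl fun a _ => Finset.sum_congr rfl fun l _ => by ring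

theorem isYetterDrinfeldModuleAlgebra (hp : IsCanonicalPairing b p) :
    IsYetterDrinfeldModuleAlgebra (pairingAction p) (coactionHom b).toLinearMap where
  action := hp.hopf.isRightHopfAction
  coaction := isLeftCoaction_coactionHom
  compat a f := by
    rw [ydRight_eq]
    refine mem_of_toUEnv_basis_mem b (ydSubalgebra hp.hopf.isRightHopfAction (coactionHom b))
      (fun j f => ?_) a f
    have hact := hp.hopf.isRightHopfAction
    have hε := sum_counit_smul (ℛ k f)
    have hε' := congrArg (TensorProduct.rid k _) (sum_tmul_counit_eq (ℛ k f))
    simp only [map_sum, TensorProduct.rid_tmul, one_smul] at hε'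
    have hL : OAut.vectorFieldLeft (isPointDerivation_pairing hp.hopf (b j)) f =
        ∑ i ∈ (ℛ k f).index, p (toUEnv k 𝔥 (b j)) ((ℛ k f).left i) • (ℛ k f).right i :=
      OAut.lid_rTensor_comul (ℛ k f)
    have hR : ∀ a, OAut.vectorFieldRight (isPointDerivation_pairing hp.hopf (b a)) f =
        ∑ i ∈ (ℛ k f).index, p (toUEnv k 𝔥 (b a)) ((ℛ k f).right i) • (ℛ k f).left i :=
      fun a => OAut.rid_lTensor_comul (ℛ k f)
    -- Primitivity of `ỹ_j` brings the left-hand side to this form, and primitivity of the `ỹ_a` the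
    -- right-hand side.
    trans (OAut.vectorFieldLeft (isPointDerivation_pairing hp.hopf (b j)) f) ⊗ₜ[k] 1 +
      coactionHom b (toUEnv k 𝔥 (b j)) * (f ⊗ₜ 1)
    · rw [ydLeft_repr _ _ _ (ℛ k f), hL]
      conv_rhs => enter [2, 2, 2]; rw [← hε]
      simp only [pairingAction_toUEnv hp.hopf, map_add, map_smul, AlgHom.toLinearMap_apply, map_one,
        add_mul, smul_mul_assoc, one_mul, Finset.sum_add_distrib, TensorProduct.sum_tmul,
        Finset.mul_sum, ← TensorProduct.smul_tmul', mul_smul_comm]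
    · rw [hp.vectorFieldLeft_apply_eq_sum, coactionHom_toUEnv_basis, map_sum, Finset.sum_mul,
        TensorProduct.sum_tmul, ← Finset.sum_add_distrib]
      refine Finset.sum_congr rfl fun a _ => ?_
      rw [ydRight_tmul_repr _ _ _ (ℛ k f), hR, Algebra.TensorProduct.tmul_mul_tmul, mul_one]
      conv_lhs => enter [2, 2, 2]; rw [← hε']
      simp only [pairingAction_toUEnv hp.hopf, Finset.mul_sum, TensorProduct.sum_tmul,
        TensorProduct.tmul_add, Finset.sum_add_distrib, TensorProduct.tmul_smul, mul_smul_comm,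
        ← TensorProduct.smul_tmul']
  lam_one := map_one (coactionHom b)
  lam_mul x y := by
    rw [map₂_mul_flip_eq_mul]
    exact map_mul (coactionHom b) x y

theorem isCanonicalCoaction (hp : IsCanonicalPairing b p) :
    IsCanonicalCoaction b (pairingAction p) (coactionHom b).toLinearMap :=
  ⟨hp.isUnitalAntimultiplicative, coactionHom_toUEnv_basis⟩

theorem eq_coactionHom (hp : IsCanonicalPairing b p) {lam : UEnv k 𝔥 →ₗ[k] OAutL b ⊗[k] UEnv k 𝔥}
    (hlam : IsCanonicalCoaction b (pairingAction p) lam) :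
    lam = (coactionHom b).toLinearMap := by
  have hc := hp.isCanonicalCoaction
  ext a : 1
  refine mem_of_toUEnv_basis_mem b
    { carrier := {a | lam a = (coactionHom b).toLinearMap a}
      add_mem' := fun {a a'} (ha : _ = _) (ha' : _ = _) => ?_
      mul_mem' := fun {a a'} (ha : _ = _) (ha' : _ = _) => ?_
      algebraMap_mem' := fun r => ?_ }
    (fun j => (hlam.apply_gen j).trans (hc.apply_gen j).symm) a
  · exact (hlam.antimul.map_mul a a').trans
      (by rw [ha, ha']; exact (hc.antimul.map_mul a a').symm)
  · exact (map_add lam a a').trans (by rw [ha, ha']; exact (map_add _ a a').symm)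
  · show lam (algebraMap k _ r) = (coactionHom b).toLinearMap (algebraMap k _ r)
    rw [Algebra.algebraMap_eq_smul_one, map_smul, map_smul, hlam.antimul.map_one,
      hc.antimul.map_one]

end IsCanonicalPairing

end RightLeibnizAlgebra

/-! ### Change of basis -/

section HopfPairing

open Coalgebra

variable {k H H' B : Type*} [Field k] [Ring H] [HopfAlgebra k H] [Ring H'] [HopfAlgebra k H']
  [Ring B] [HopfAlgebra k B]

/-- Hopf pairings pull back along bialgebra maps. -/
lemma IsHopfPairing.comp_bialgHom {p : B →ₗ[k] H →ₗ[k] k} (hp : IsHopfPairing p)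
    (θ : H' →ₐc[k] H) : IsHopfPairing (p.compl₂ (θ : H' →ₗ[k] H)) where
  mul_right b g h := by
    rw [dualDistrib_map_comul _ (ℛ k b)]
    simp [hp.mul_right_apply (ℛ k b)]
  one_right b := by simp [hp.one_right]
  mul_left b c h := by
    rw [dualDistrib_comul _ _ (ℛ k h)]
    simp only [LinearMap.compl₂_apply]
    exact hp.mul_left_apply b c ((ℛ k h).induced θ)
  one_left h := by simp [hp.one_left]

end HopfPairing

namespace OAut

open Coalgebra

variable {k L : Type*} [Field k] [AddCommGroup L] [Module k L] {n : ℕ}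
  {μ : L →ₗ[k] L →ₗ[k] L} {b : Module.Basis (Fin n) k L}
  {R : Type*} [CommRing R] [Algebra k R]

/-- Algebra maps out of `O(Aut(L))` agree as soon as they agree on the matrix `G`, because the
inverse of a matrix is unique. -/
lemma hom_ext_G {S : Type*} [Semiring S] [Algebra k S] {f g : OAut μ b →ₐ[k] S}
    (hM : (G μ b).map f = (G μ b).map g) : f = g := by
  have h1 : (Gbar μ b).map f * (G μ b).map f = 1 := by
    rw [← Matrix.map_mul, Gbar_mul_G, Matrix.map_one f (map_zero f) (map_one f)]
  have h2 : (G μ b).map f * (Gbar μ b).map g = 1 := by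
    rw [hM, ← Matrix.map_mul, G_mul_Gbar, Matrix.map_one g (map_zero g) (map_one g)]
  have h3 := left_inv_eq_right_inv h1 h2
  exact hom_ext (fun i j => congrFun (congrFun hM i) j) fun i j => congrFun (congrFun h3 i) j

/-- The matrix `M` takes the product with structure constants `C'` to the one with structure
constants `C`. The case `C = C'` is `RespectsProduct C M`. -/
def IntertwinesProducts (C C' : Fin n → Fin n → Fin n → k) (M : Matrix (Fin n) (Fin n) R) : Prop :=
  ∀ r i j, ∑ l, ∑ m, algebraMap k R (C r l m) * M l i * M m j =
    ∑ l, M r l * algebraMap k R (C' l i j)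

lemma IntertwinesProducts.mul {C C' C'' : Fin n → Fin n → Fin n → k}
    {M N : Matrix (Fin n) (Fin n) R} (hM : IntertwinesProducts C C' M)
    (hN : IntertwinesProducts C' C'' N) : IntertwinesProducts C C'' (M * N) := by
  intro r i j
  calc ∑ l, ∑ m, algebraMap k R (C r l m) * (M * N) l i * (M * N) m j
      = ∑ l, ∑ m, ∑ p, ∑ q, (algebraMap k R (C r l m) * M l p * M m q) * (N p i * N q j) := by
        refine Finset.sum_congr rfl fun l _ => Finset.sum_congr rfl fun m _ => ?_
        rw [Matrix.mul_apply, Matrix.mul_apply, mul_assoc, Finset.sum_mul_sum, Finset.mul_sum]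
        refine Finset.sum_congr rfl fun p _ => ?_
        rw [Finset.mul_sum]
        exact Finset.sum_congr rfl fun q _ => by ring
    _ = ∑ l, ∑ p, ∑ m, ∑ q, (algebraMap k R (C r l m) * M l p * M m q) * (N p i * N q j) :=
        Finset.sum_congr rfl fun l _ => Finset.sum_comm
    _ = ∑ p, ∑ l, ∑ m, ∑ q, (algebraMap k R (C r l m) * M l p * M m q) * (N p i * N q j) :=
        Finset.sum_comm
    _ = ∑ p, ∑ l, ∑ q, ∑ m, (algebraMap k R (C r l m) * M l p * M m q) * (N p i * N q j) :=
        Finset.sum_congr rfl fun p _ => Finset.sum_congr rfl fun l _ => Finset.sum_comm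
    _ = ∑ p, ∑ q, ∑ l, ∑ m, (algebraMap k R (C r l m) * M l p * M m q) * (N p i * N q j) :=
        Finset.sum_congr rfl fun p _ => Finset.sum_comm
    _ = ∑ p, ∑ q, ∑ s, M r s * algebraMap k R (C' s p q) * (N p i * N q j) := by
        simp only [← Finset.sum_mul, hM r _ _]
    _ = ∑ p, ∑ s, ∑ q, M r s * algebraMap k R (C' s p q) * (N p i * N q j) :=
        Finset.sum_congr rfl fun p _ => Finset.sum_comm
    _ = ∑ s, ∑ p, ∑ q, M r s * algebraMap k R (C' s p q) * (N p i * N q j) := Finset.sum_comm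
    _ = ∑ s, M r s * ∑ p, ∑ q, algebraMap k R (C' s p q) * N p i * N q j := by
        refine Finset.sum_congr rfl fun s _ => ?_
        simp only [Finset.mul_sum]
        exact Finset.sum_congr rfl fun p _ => Finset.sum_congr rfl fun q _ => by ring
    _ = ∑ s, ∑ t, M r s * (N s t * algebraMap k R (C'' t i j)) := by
        simp only [hN _ i j, Finset.mul_sum]
    _ = ∑ t, (M * N) r t * algebraMap k R (C'' t i j) := by
        simp only [Matrix.mul_apply, Finset.sum_mul, mul_assoc]
        exact Finset.sum_comm

/-- The transition matrix between two bases intertwines the structure constants. -/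
lemma intertwinesProducts_toMatrix (μ : L →ₗ[k] L →ₗ[k] L) (b b' : Module.Basis (Fin n) k L) :
    IntertwinesProducts (R := R) (structConst μ b) (structConst μ b')
      ((b.toMatrix b').map (algebraMap k R)) := by
  intro r i j
  have h : ∑ l, ∑ m, structConst μ b r l m * b.repr (b' i) l * b.repr (b' j) m =
      ∑ l, b.repr (b' l) r * structConst μ b' l i j := by
    have h1 := repr_map_apply b' b .id (μ (b' i) (b' j)) r
    simp only [LinearMap.id_apply] at h1
    rw [show (∑ l, b.repr (b' l) r * structConst μ b' l i j) = _ from h1.symm,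
      show μ (b' i) (b' j) = μ.flip (b' j) (b' i) from rfl, repr_map_apply b b]
    refine Finset.sum_congr rfl fun l _ => ?_
    rw [LinearMap.flip_apply, repr_map_apply b b (μ (b l)) (b' j), Finset.sum_mul]
    exact Finset.sum_congr rfl fun m _ => by rw [structConst]; ring
  have := congrArg (algebraMap k R) h
  simpa [map_sum, Module.Basis.toMatrix_apply] using this

/-- The matrix `T⁻¹ M T`, where `T` is the transition matrix from `b` to `b'`. -/
def conjToMatrix (b b' : Module.Basis (Fin n) k L) (M : Matrix (Fin n) (Fin n) R) :
    Matrix (Fin n) (Fin n) R :=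
  (b'.toMatrix b).map (algebraMap k R) * M * (b.toMatrix b').map (algebraMap k R)

lemma conjToMatrix_apply (b b' : Module.Basis (Fin n) k L) (M : Matrix (Fin n) (Fin n) R)
    (i j : Fin n) : conjToMatrix b b' M i j =
      ∑ l, ∑ m, (b'.toMatrix b i l * b.toMatrix b' m j) • M l m := by
  simp only [conjToMatrix, Matrix.mul_apply, Matrix.map_apply, Finset.sum_mul]
  rw [Finset.sum_comm]
  refine Finset.sum_congr rfl fun l _ => Finset.sum_congr rfl fun m _ => ?_
  rw [Algebra.smul_def, map_mul]
  ring

lemma toMatrix_map_mul_flip (b b' : Module.Basis (Fin n) k L) :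
    (b.toMatrix b').map (algebraMap k R) * (b'.toMatrix b).map (algebraMap k R) = 1 := by
  rw [← Matrix.map_mul, Module.Basis.toMatrix_mul_toMatrix_flip,
    Matrix.map_one _ (map_zero _) (map_one _)]

lemma conjToMatrix_mul (b b' : Module.Basis (Fin n) k L) (M N : Matrix (Fin n) (Fin n) R) :
    conjToMatrix b b' (M * N) = conjToMatrix b b' M * conjToMatrix b b' N := by
  have h := toMatrix_map_mul_flip (R := R) b b'
  simp only [conjToMatrix, Matrix.mul_assoc]
  rw [← Matrix.mul_assoc ((b.toMatrix b').map _) ((b'.toMatrix b).map _), h, Matrix.one_mul]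

lemma conjToMatrix_one (b b' : Module.Basis (Fin n) k L) :
    conjToMatrix b b' (1 : Matrix (Fin n) (Fin n) R) = 1 := by
  rw [conjToMatrix, Matrix.mul_one, toMatrix_map_mul_flip]

lemma conjToMatrix_conjToMatrix (b b' : Module.Basis (Fin n) k L) (M : Matrix (Fin n) (Fin n) R) :
    conjToMatrix b' b (conjToMatrix b b' M) = M := by
  have h := toMatrix_map_mul_flip (R := R) b b'
  simp only [conjToMatrix, ← Matrix.mul_assoc]
  rw [h, Matrix.one_mul, Matrix.mul_assoc, h, Matrix.mul_one]

lemma conjToMatrix_map {S : Type*} [CommRing S] [Algebra k S] (b b' : Module.Basis (Fin n) k L)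
    (M : Matrix (Fin n) (Fin n) R) (f : R →ₐ[k] S) :
    (conjToMatrix b b' M).map f = conjToMatrix b b' (M.map f) := by
  have h : ∀ T : Matrix (Fin n) (Fin n) k,
      (T.map (algebraMap k R)).map f = T.map (algebraMap k S) := fun T => by
    ext i j
    simp
  rw [conjToMatrix, Matrix.map_mul, Matrix.map_mul, h, h, conjToMatrix]

lemma respectsProduct_conjToMatrix (b b' : Module.Basis (Fin n) k L)
    {M : Matrix (Fin n) (Fin n) R} (hM : RespectsProduct (structConst μ b) M) :
    RespectsProduct (structConst μ b') (conjToMatrix b b' M) :=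
  ((intertwinesProducts_toMatrix μ b' b).mul hM).mul (intertwinesProducts_toMatrix μ b b')

variable (μ) in
/-- The change of coordinates `G_{b'} ↦ T⁻¹ G_b T`, `Ḡ_{b'} ↦ T⁻¹ Ḡ_b T`. -/
def changeBasisHom (b b' : Module.Basis (Fin n) k L) : OAut μ b' →ₐ[k] OAut μ b :=
  lift (conjToMatrix b b' (G μ b)) (conjToMatrix b b' (Gbar μ b))
    (by rw [← conjToMatrix_mul, G_mul_Gbar, conjToMatrix_one])
    (by rw [← conjToMatrix_mul, Gbar_mul_G, conjToMatrix_one])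
    (respectsProduct_conjToMatrix b b' (respects_G μ b))

lemma changeBasisHom_G (b b' : Module.Basis (Fin n) k L) (i j : Fin n) :
    changeBasisHom μ b b' (G μ b' i j) = conjToMatrix b b' (G μ b) i j := by
  rw [changeBasisHom, lift_G]

lemma changeBasisHom_Gbar (b b' : Module.Basis (Fin n) k L) (i j : Fin n) :
    changeBasisHom μ b b' (Gbar μ b' i j) = conjToMatrix b b' (Gbar μ b) i j := by
  rw [changeBasisHom, lift_Gbar]

lemma map_changeBasisHom_G (b b' : Module.Basis (Fin n) k L) :
    (G μ b').map (changeBasisHom μ b b') = conjToMatrix b b' (G μ b) := by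
  ext i j
  exact changeBasisHom_G b b' i j

lemma changeBasisHom_comp (b b' : Module.Basis (Fin n) k L) :
    (changeBasisHom μ b b').comp (changeBasisHom μ b' b) = AlgHom.id k _ := by
  refine hom_ext_G ?_
  rw [AlgHom.coe_comp, ← Matrix.map_map, map_changeBasisHom_G, conjToMatrix_map,
    map_changeBasisHom_G, conjToMatrix_conjToMatrix]
  simp

lemma map_counit_G : (G μ b).map (Bialgebra.counitAlgHom k (OAut μ b)) = 1 := by
  ext i j
  simp [Matrix.one_apply]

lemma map_comul_G : (G μ b).map (Bialgebra.comulAlgHom k (OAut μ b)) = GLeft μ b * GRight μ b := by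
  ext i j
  change comulHom μ b (G μ b i j) = _
  rw [comulHom, lift_G]

variable (μ) in
/-- The Hopf algebra isomorphism between the presentations of `O(Aut(L))` in two bases. -/
def changeBasis (b b' : Module.Basis (Fin n) k L) : OAut μ b' ≃ₐc[k] OAut μ b :=
  BialgEquiv.ofAlgEquiv
    (AlgEquiv.ofAlgHom (changeBasisHom μ b b') (changeBasisHom μ b' b)
      (changeBasisHom_comp b b') (changeBasisHom_comp b' b))
    (by
      refine hom_ext_G ?_
      change (G μ b').map (⇑(Bialgebra.counitAlgHom k _) ∘ ⇑(changeBasisHom μ b b')) = _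
      rw [← Matrix.map_map, map_changeBasisHom_G, conjToMatrix_map]
      rw [map_counit_G, map_counit_G, conjToMatrix_one])
    (by
      have hL : (GLeft μ b').map (Algebra.TensorProduct.map (changeBasisHom μ b b')
          (changeBasisHom μ b b')) = conjToMatrix b b' (GLeft μ b) := by
        rw [GLeft, GLeft, ← conjToMatrix_map, ← map_changeBasisHom_G]
        ext i j
        simp
      have hR : (GRight μ b').map (Algebra.TensorProduct.map (changeBasisHom μ b b')
          (changeBasisHom μ b b')) = conjToMatrix b b' (GRight μ b) := by
        rw [GRight, GRight, ← conjToMatrix_map, ← map_changeBasisHom_G]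
        ext i j
        simp
      refine hom_ext_G ?_
      trans conjToMatrix b b' (GLeft μ b * GRight μ b)
      · rw [conjToMatrix_mul, ← hL, ← hR, ← Matrix.map_mul, ← map_comul_G, Matrix.map_map]
        rfl
      · rw [← map_comul_G, ← conjToMatrix_map, ← map_changeBasisHom_G, Matrix.map_map]
        rfl)

lemma changeBasis_G (b b' : Module.Basis (Fin n) k L) (i j : Fin n) :
    changeBasis μ b b' (G μ b' i j) =
      ∑ l, ∑ m, (b'.toMatrix b i l * b.toMatrix b' m j) • G μ b l m := by
  rw [← conjToMatrix_apply]
  exact changeBasisHom_G b b' i j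

lemma changeBasis_Gbar (b b' : Module.Basis (Fin n) k L) (i j : Fin n) :
    changeBasis μ b b' (Gbar μ b' i j) =
      ∑ l, ∑ m, (b'.toMatrix b i l * b.toMatrix b' m j) • Gbar μ b l m := by
  rw [← conjToMatrix_apply]
  exact changeBasisHom_Gbar b b' i j

end OAut

namespace RightLeibnizAlgebra

open UniversalEnvelopingAlgebra Coalgebra

variable {k 𝔥 : Type*} [Field k] [AddCommGroup 𝔥] [Module k 𝔥] [RightLeibnizAlgebra k 𝔥] {n : ℕ}
  {b : Module.Basis (Fin n) k 𝔥} {p : UEnv k 𝔥 →ₗ[k] OAutL b →ₗ[k] k}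

lemma IsCanonicalPairing.changeBasis (hp : IsCanonicalPairing b p)
    (b' : Module.Basis (Fin n) k 𝔥) :
    IsCanonicalPairing b' (p.compl₂ (OAut.changeBasis br b b' : OAutL b' →ₗ[k] OAutL b)) where
  hopf := hp.hopf.comp_bialgHom (OAut.changeBasis br b b' : OAutL b' →ₐc[k] OAutL b)
  apply_G i j l := by
    have h : p (toUEnv k 𝔥 (b' l)) (OAut.changeBasis br b b' (OAut.G br b' i j)) =
        -structConst br b' i j l := by
      have h1 := OAut.repr_map_apply b b' ((br (k := k)).flip (b' l)) (b' j) i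
      have h2 := fun x => OAut.repr_map_apply b b' .id x i
      simp only [LinearMap.id_apply, LinearMap.flip_apply] at h1 h2
      rw [structConst, h1, OAut.changeBasis_G]
      simp only [map_sum, map_smul, hp.apply_toUEnv_G, h2 (br (k := k) _ _), Finset.sum_mul,
        Module.Basis.toMatrix_apply, smul_eq_mul, mul_neg, Finset.sum_neg_distrib]
      rw [Finset.sum_comm]
      congr 1
      exact Finset.sum_congr rfl fun _ _ => Finset.sum_congr rfl fun _ _ => by ring
    exact h

lemma rTensor_changeBasis_coactionHom (b b' : Module.Basis (Fin n) k 𝔥) (u : UEnv k 𝔥) :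
    (OAut.changeBasis br b b' : OAutL b' →ₗ[k] OAutL b).rTensor (UEnv k 𝔥) (coactionHom b' u) =
      coactionHom b u := by
  refine DFunLike.congr_fun (show (Algebra.TensorProduct.map
    (OAut.changeBasis br b b' : OAutL b' →ₐ[k] OAutL b) (.id k _)).comp (coactionHom b') =
      coactionHom b from algHom_ext_toUEnv_basis b' fun j => ?_) u
  have h1 : ∀ l, toUEnv k 𝔥 (b l) = ∑ i, b'.repr (b l) i • toUEnv k 𝔥 (b' i) := by
    intro l
    conv_lhs => rw [← b'.sum_repr (b l), ← toUEnvLin_apply, map_sum]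
    simp only [map_smul]
    rfl
  have h2 : coactionHom b (toUEnv k 𝔥 (b' j)) =
      ∑ m, b.repr (b' j) m • ∑ l, OAut.Gbar br b l m ⊗ₜ[k] toUEnv k 𝔥 (b l) := by
    rw [coactionHom_toUEnv]
    conv_lhs => rw [← b.sum_repr (b' j), map_sum]
    simp only [map_smul, genericInverse_basis]
  rw [h2, AlgHom.comp_apply, coactionHom_toUEnv_basis, map_sum]
  have h3 : ∀ i, Algebra.TensorProduct.map
      (OAut.changeBasis br b b' : OAutL b' →ₐ[k] OAutL b) (.id k (UEnv k 𝔥))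
      (OAut.Gbar br b' i j ⊗ₜ toUEnv k 𝔥 (b' i)) =
      ∑ l, ∑ m, (b'.repr (b l) i * b.repr (b' j) m) • (OAut.Gbar br b l m ⊗ₜ[k]
        toUEnv k 𝔥 (b' i)) := by
    intro i
    refine Eq.trans (congrArg (· ⊗ₜ[k] toUEnv k 𝔥 (b' i)) (OAut.changeBasis_Gbar b b' i j)) ?_
    simp only [TensorProduct.sum_tmul, ← TensorProduct.smul_tmul', Module.Basis.toMatrix_apply]
  simp only [h3, h1, Finset.smul_sum, TensorProduct.tmul_sum, TensorProduct.tmul_smul, smul_smul]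
  rw [Finset.sum_comm]
  simp only [mul_comm (b.repr (b' j) _)]
  trans ∑ l, ∑ m, ∑ i, (b'.repr (b l) i * b.repr (b' j) m) • (OAut.Gbar br b l m ⊗ₜ[k]
        toUEnv k 𝔥 (b' i))
  · exact Finset.sum_congr rfl fun l _ => Finset.sum_comm
  · exact Finset.sum_comm

end RightLeibnizAlgebra

end

open RightLeibnizAlgebra in
theorem theorem3p6 {k 𝔥 : Type*} [Field k] [AddCommGroup 𝔥] [Module k 𝔥]
    [RightLeibnizAlgebra k 𝔥] {n : ℕ} (b : Module.Basis (Fin n) k 𝔥) :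
    ∃ p : UEnv k 𝔥 →ₗ[k] OAutL b →ₗ[k] k,
      IsCanonicalPairing b p ∧ (∀ p', IsCanonicalPairing b p' → p' = p) ∧
      IsRightHopfAction (pairingAction p) ∧
      IsSmashProductAlgebra (pairingAction p) ∧
      ∃ lam : UEnv k 𝔥 →ₗ[k] OAutL b ⊗[k] UEnv k 𝔥,
        IsCanonicalCoaction b (pairingAction p) lam ∧
        (∀ lam', IsCanonicalCoaction b (pairingAction p) lam' → lam' = lam) ∧
        IsLeftCoaction lam ∧
        IsYetterDrinfeldModuleAlgebra (pairingAction p) lam ∧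
        IsBraidedCommutative (pairingAction p) lam ∧
        -- independence of the basis
        ∀ b' : Module.Basis (Fin n) k 𝔥, ∃ θ : OAutL b' ≃ₐc[k] OAutL b,
          (∀ i j, θ (OAut.G br b' i j) =
            ∑ l, ∑ m, (b'.toMatrix b i l * b.toMatrix b' m j) • OAut.G br b l m) ∧
          (∀ i j, θ (OAut.Gbar br b' i j) =
            ∑ l, ∑ m, (b'.toMatrix b i l * b.toMatrix b' m j) • OAut.Gbar br b l m) ∧
          ∀ p', IsCanonicalPairing b' p' →
            (∀ u f, p u (θ f) = p' u f) ∧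
            (∀ u f, pairingAction p u (θ f) = pairingAction p' u f) ∧
            ∀ lam', IsCanonicalCoaction b' (pairingAction p') lam' →
              ∀ u, lam u = (θ : OAutL b' →ₗ[k] OAutL b).rTensor (UEnv k 𝔥) (lam' u) := by
  have hp := isCanonicalPairing_canonicalPairing b
  refine ⟨canonicalPairing b, hp, fun p' hp' => hp'.eq_canonicalPairing,
    hp.hopf.isRightHopfAction, hp.hopf.isRightHopfAction.isSmashProductAlgebra,
    (coactionHom b).toLinearMap, hp.isCanonicalCoaction, fun lam' h => hp.eq_coactionHom h,
    isLeftCoaction_coactionHom, hp.isYetterDrinfeldModuleAlgebra, hp.isBraidedCommutative,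
    fun b' => ⟨OAut.changeBasis br b b', OAut.changeBasis_G b b', OAut.changeBasis_Gbar b b',
      fun p' hp' => ?_⟩⟩
  have hpθ : ∀ u f, canonicalPairing b u (OAut.changeBasis br b b' f) = p' u f := fun u f => by
    rw [hp'.eq_canonicalPairing, ← (hp.changeBasis b').eq_canonicalPairing]
    rfl
  refine ⟨hpθ, fun u f => ?_, fun lam' hlam' u => ?_⟩
  · simp only [pairingAction_repr _ (Coalgebra.Repr.arbitrary k u), hpθ]
  · rw [hp'.eq_coactionHom hlam']
    exact (rTensor_changeBasis_coactionHom b b' u).symm
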